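/- Let $A\in\mathbb R^{n\times n}$, $B\in\mathbb R^{n\times m}$, let $Q\in\mathbb R^{n\times n}$ be symmetric positive semidefinite, $R\in\mathbb R^{m\times m}$ symmetric positive definite, and $\Sigma_v\in\mathbb R^{n\times n}$ symmetric positive semidefinite. For $p\in(0,1)$ consider the system $$x_{t+1}=Ax_t+(1-\beta_t)\alpha_tBu_t+v_t,\qquad t=0,1,2,\dots,$$ where the transmission decisions $\alpha_t$ are i.i.d. Bernoulli$(p)$, the noises $v_t$ are i.i.d. $\mathcal N(0,\Sigma_v)$, the initial state $x_0$ has a finite second moment, and $x_0$, $(\alpha_t)_t$, $(v_t)_t$ are independent. The attacker uses the dominant closed-loop attack $\gamma_A^*$, given by $\beta_t=\alpha_{t-1}$ for all $t\ge 0$, where $\alpha_{-1}\in\{0,1\}$ is a fixed constant. A controller strategy $\gamma_C=(\gamma_t^C)_{t\ge0}$ consists of measurable maps with $u_t=\gamma^C_t(x_0,\dots,x_t,\alpha_0,\dots,\alpha_{t-1})\in\mathbb R^m$; $\Gamma_C$ denotes the set of all of them. Put $$J_C^N(\gamma_C,\gamma_A^*)=\mathbb E\Big[x_N^TQx_N+\sum_{t=0}^{N-1}\big(x_t^TQx_t+(1-\beta_t)\alpha_tu_t^TRu_t\big)\Big],$$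 $$J_C^\infty(\gamma_C,\gamma_A^*)=\limsup_{N\to\infty}\frac1N\,\mathbb E\Big[\sum_{t=0}^{N-1}\big(x_t^TQx_t+(1-\beta_t)\alpha_tu_t^TRu_t\big)\Big].$$ (i) For every $p\in(0,1)$ and every horizon $N$ there is $\gamma_C^*\in\Gamma_C$ with $J_C^N(\gamma_C^*,\gamma_A^*)\le J_C^N(\gamma_C,\gamma_A^*)$ for all $\gamma_C\in\Gamma_C$, such that for each $i\in\{0,\dots,N-1\}$ the control $\gamma_i^{C^*}$ is a linear function of $x_i$ alone: $\gamma_i^{C^*}(x_0,\dots,x_i,\alpha_0,\dots,\alpha_{i-1})=K_ix_i$ for a matrix $K_i\in\mathbb R^{m\times n}$. (ii) Suppose that $(A,B)$ and $(A,Q^{1/2})$ are controllable, and let $\rho_{\min}$ be the infimum of all $\rho\in[0,1]$ for which there are $Y\in\mathbb R^{n\times n}$ symmetric with $0\le Y\le I$ and $Z\in\mathbb R^{n\times m}$ such that $$\begin{bmatrix}Y&\sqrt\rho\,(YA^T+ZB^T)&\sqrt{1-\rho}\,YA^T\\ \sqrt\rho\,(AY+BZ^T)&Y&0\\ \sqrt{1-\rho}\,AY&0&Y\end{bmatrix}>0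 .$$ This infimum exists (the set of such $\rho$ is non-empty), and for every $p\in(0,1)$ with $p(1-p)>\rho_{\min}$ there is $\gamma_C^*\in\Gamma_C$ with $J_C^\infty(\gamma_C^*,\gamma_A^*)\le J_C^\infty(\gamma_C,\gamma_A^*)$ for all $\gamma_C\in\Gamma_C$ and $J_C^\infty(\gamma_C^*,\gamma_A^*)<\infty$. -/

import Mathlib

open MeasureTheory ProbabilityTheory Filter Matrix
open scoped MatrixOrder ENNReal

namespace BusOff

/-! ### Policies -/

/-- A controller strategy: at time `t` the control is a measurable function of the states
`x_0, …, x_t` and of the past transmission decisions `α_0, …, α_{t-1}`. -/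
structure ControlStrategy (n m : ℕ) where
  act : (t : ℕ) → (Fin (t + 1) → (Fin n → ℝ)) → (Fin t → Bool) → (Fin m → ℝ)
  measurable_act : ∀ t, Measurable
    (fun h : (Fin (t + 1) → (Fin n → ℝ)) × (Fin t → Bool) => act t h.1 h.2)

/-- A (non-randomized) closed-loop attack: at time `t` the attacker decides whether to send a
message, as a function of the past transmission decisions `α_0, …, α_{t-1}`. -/
abbrev AttackPolicy : Type := (t : ℕ) → (Fin t → Bool) → Bool

/-- The attack that jams exactly one step after every transmission, `β_t = α_{t-1}`. The decision
`β_0 = α_{-1}` is the constant `a₀`. -/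
def followAttack (a₀ : Bool) : AttackPolicy
  | 0, _ => a₀
  | t + 1, h => h (Fin.last t)

/-! ### Probability space -/

/-- Sample points: the initial state, the transmission decisions `(α_t)` and the noise `(v_t)`. -/
abbrev Sample (n : ℕ) : Type := (Fin n → ℝ) × (ℕ → Bool) × (ℕ → (Fin n → ℝ))

/-- The centred Gaussian law on `ℝⁿ` with covariance matrix `S`. -/
noncomputable def noiseLaw {n : ℕ} (S : Matrix (Fin n) (Fin n) ℝ) : Measure (Fin n → ℝ) :=
  (multivariateGaussian (0 : EuclideanSpace ℝ (Fin n)) S).map WithLp.ofLp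

/-- Under `sampleLaw μ₀ p S` the initial state has law `μ₀`, the `α_t` are i.i.d. Bernoulli with
parameter `p`, the `v_t` are i.i.d. centred Gaussian with covariance `S`, and the initial state,
`(α_t)` and `(v_t)` are independent. -/
noncomputable def sampleLaw {n : ℕ} (μ₀ : Measure (Fin n → ℝ)) (p : unitInterval)
    (S : Matrix (Fin n) (Fin n) ℝ) : Measure (Sample n) :=
  μ₀.prod ((Measure.infinitePi fun _ : ℕ => bernoulliMeasure true false p).prod
    (Measure.infinitePi fun _ : ℕ => noiseLaw S))

/-! ### Controlled system -/

/-- The numerical value of a decision. -/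
def num (b : Bool) : ℝ := if b then 1 else 0

section System

variable {n m : ℕ} (A : Matrix (Fin n) (Fin n) ℝ) (B : Matrix (Fin n) (Fin m) ℝ)
  (γ : ControlStrategy n m) (β : AttackPolicy) (ω : Sample n)

/-- The past transmission decisions `α_0, …, α_{t-1}`. -/
def pastTx (t : ℕ) : Fin t → Bool := fun i => ω.2.1 i

/-- The number `(1 - β_t) α_t`, which is `1` if the control of time `t` is delivered. -/
def delivered (t : ℕ) : ℝ := (1 - num (β t (pastTx ω t))) * num (ω.2.1 t)

/-- The states `x_0, …, x_t`, where `x_{t+1} = A x_t + (1 - β_t) α_t B u_t + v_t`. -/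
def history : (t : ℕ) → (Fin (t + 1) → (Fin n → ℝ))
  | 0 => fun _ => ω.1
  | t + 1 => Fin.snoc (α := fun _ => Fin n → ℝ) (history t)
      (A *ᵥ history t (Fin.last t)
        + delivered β ω t • (B *ᵥ γ.act t (history t) (pastTx ω t)) + ω.2.2 t)

/-- The state `x_t`. -/
def state (t : ℕ) : Fin n → ℝ := history A B γ β ω t (Fin.last t)

/-- The control `u_t`. -/
def controlInput (t : ℕ) : Fin m → ℝ := γ.act t (history A B γ β ω t) (pastTx ω t)

/-- The stage cost `x_tᵀ Q x_t + (1 - β_t) α_t u_tᵀ R u_t`. -/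
def stageCost (Q : Matrix (Fin n) (Fin n) ℝ) (R : Matrix (Fin m) (Fin m) ℝ) (t : ℕ) : ℝ :=
  state A B γ β ω t ⬝ᵥ (Q *ᵥ state A B γ β ω t)
    + delivered β ω t * (controlInput A B γ β ω t ⬝ᵥ (R *ᵥ controlInput A B γ β ω t))

end System

/-! ### Cost functionals

All costs are nonnegative when `Q` is positive semidefinite and `R` is positive definite, so that
the expectations are defined in `[0, ∞]`. -/

section Costs

variable {n m : ℕ} (A : Matrix (Fin n) (Fin n) ℝ) (B : Matrix (Fin n) (Fin m) ℝ)
  (Q : Matrix (Fin n) (Fin n) ℝ) (R : Matrix (Fin m) (Fin m) ℝ) (P : Measure (Sample n))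
  (γ : ControlStrategy n m) (β : AttackPolicy)

/-- The expected cost over the horizon `N`, with the terminal cost `x_Nᵀ Q x_N`. -/
noncomputable def finiteCost (N : ℕ) : ℝ≥0∞ :=
  ∫⁻ ω, ENNReal.ofReal (state A B γ β ω N ⬝ᵥ (Q *ᵥ state A B γ β ω N)
    + ∑ t ∈ Finset.range N, stageCost A B γ β ω Q R t) ∂P

/-- The long-run average expected cost, without terminal cost. -/
noncomputable def averageCost : ℝ≥0∞ :=
  limsup (fun N : ℕ => (N : ℝ≥0∞)⁻¹ *
    ∫⁻ ω, ENNReal.ofReal (∑ t ∈ Finset.range N, stageCost A B γ β ω Q R t) ∂P) atTop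

end Costs

/-! ### Controllability and the critical value -/

/-- Kalman's rank condition: the matrix `[B, AB, …, A^{n-1}B]` has rank `n`. -/
def Controllable {n m : ℕ} (A : Matrix (Fin n) (Fin n) ℝ) (B : Matrix (Fin n) (Fin m) ℝ) : Prop :=
  (Matrix.of fun (i : Fin n) (kj : Fin n × Fin m) => (A ^ (kj.1 : ℕ) * B) i kj.2).rank = n

/-- The block matrix
`[[Y, √ρ (Y Aᵀ + Z Bᵀ), √(1-ρ) Y Aᵀ], [√ρ (A Y + B Zᵀ), Y, 0], [√(1-ρ) A Y, 0, Y]]`. -/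
noncomputable def lmiMatrix {n m : ℕ} (A : Matrix (Fin n) (Fin n) ℝ) (B : Matrix (Fin n) (Fin m) ℝ)
    (ρ : ℝ) (Y : Matrix (Fin n) (Fin n) ℝ) (Z : Matrix (Fin n) (Fin m) ℝ) :
    Matrix (Fin n ⊕ (Fin n ⊕ Fin n)) (Fin n ⊕ (Fin n ⊕ Fin n)) ℝ :=
  fromBlocks Y
    (fromCols (√ρ • (Y * Aᵀ + Z * Bᵀ)) (√(1 - ρ) • (Y * Aᵀ)))
    (fromRows (√ρ • (A * Y + B * Zᵀ)) (√(1 - ρ) • (A * Y)))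
    (fromBlocks Y 0 0 Y)

/-- The `ρ ∈ [0, 1]` for which the linear matrix inequality `lmiMatrix A B ρ Y Z > 0` has a
solution `(Y, Z)` with `0 ≤ Y ≤ I`. -/
def feasibleRates {n m : ℕ} (A : Matrix (Fin n) (Fin n) ℝ) (B : Matrix (Fin n) (Fin m) ℝ) :
    Set ℝ :=
  {ρ | 0 ≤ ρ ∧ ρ ≤ 1 ∧ ∃ (Y : Matrix (Fin n) (Fin n) ℝ) (Z : Matrix (Fin n) (Fin m) ℝ),
    Y.PosSemidef ∧ (1 - Y).PosSemidef ∧ (lmiMatrix A B ρ Y Z).PosDef}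

end BusOff

/-!
Under the following attack the pair of the state `x_t` and the decision `β_t = α_{t-1}` is a Markov
jump system with two modes: in the jammed mode `true` no control arrives, in the free mode `false`
it arrives with probability `p`, and the next mode is `true` with probability `p` in either case.
Dynamic programming with cost-to-go `xᵀ P_β x + const` gives the coupled recursion `riccati` for the
pair of matrices `P`. The inequality `expForm_riccati_add_le`, an equality for the feedback
`u = K x` with `K = optGain`, is obtained by integrating out the decision and the noise of a
single time step (`lintegral_sampleLaw`). Summed over `N` steps with terminal matrices `Q`, it shows
that linear feedbacks of the current state are optimal on a finite horizon
(`exists_finiteCost_optimal`).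

For the average cost, the recursion is started at zero. If its monotone iterates converge, the
feedback of the limit is optimal, since its average cost is at most the Cesàro limit of the
constants `tr (S M_k)`, which bounds every strategy from below (`averageCost_le_of_fixedPoint`,
`le_averageCost`). Convergence amounts to boundedness. The mean `M = p P_true + (1 - p) P_false`
satisfies `M_{k+1} = Q + Aᵀ (M_k - ρ X_k) A` with `ρ = p (1 - p)`, where `X_k` is the reduction of
`P_true` by an optimal control. If `M_k` were unbounded, a normalized limit `(M, X)` would satisfy
`M ≤ Aᵀ (M - ρ X) A`, `X ≤ Aᵀ M A` and `Bᵀ M B ≤ Bᵀ X B` (`exists_homogeneous_of_unbounded`). The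
kernel of `M` is then `A`-invariant, and on the quotient `M` becomes the identity
(`exists_quotient`). With `A'` the induced map and `s` the rank of the induced `B`, a comparison of
determinants yields `1 ≤ (det A')² (1 - ρ) ^ s` (`one_le_det_sq_mul`). On the other hand, the linear
matrix inequality at some `ρ₀ < ρ` passes to the quotient as a contraction property
(`exists_contraction_of_lmi`), which forces `(det A')² (1 - ρ₀) ^ s < 1` (`det_sq_mul_lt_one`).
This is a contradiction (`exists_trace_le_of_feasible`).

The set of feasible rates contains `1` when `(A, B)` is controllable (`one_mem_feasibleRates`): the
same blow-up argument at `ρ = 1` shows that the standard Riccati iteration is bounded, because the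
limit would annihilate `B` on a nonzero quotient, and its fixed point solves the inequality.
-/

namespace BusOff

/-! ### Real positive semidefinite matrices -/

section PosSemidef

variable {ι κ : Type*} [Fintype ι] [Fintype κ]

theorem transpose_eq_of_posSemidef {ι : Type*} {P : Matrix ι ι ℝ} (hP : P.PosSemidef) : Pᵀ = P := by
  simpa using hP.1.eq

theorem posSemidef_transpose_mul_mul {M : Matrix ι ι ℝ} (hM : M.PosSemidef) (C : Matrix ι κ ℝ) :
    (Cᵀ * M * C).PosSemidef := by
  simpa using hM.conjTranspose_mul_mul_same C

theorem transpose_mul_mul_mono {M N : Matrix ι ι ℝ} (h : M ≤ N) (C : Matrix ι κ ℝ) :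
    Cᵀ * M * C ≤ Cᵀ * N * C := by
  have := posSemidef_transpose_mul_mul (Matrix.le_iff.1 h) C
  rwa [Matrix.mul_sub, Matrix.sub_mul] at this

theorem dotProduct_transpose_mul_mul (M : Matrix ι ι ℝ) (C : Matrix ι κ ℝ) (x : κ → ℝ) :
    x ⬝ᵥ (Cᵀ * M * C) *ᵥ x = (C *ᵥ x) ⬝ᵥ M *ᵥ (C *ᵥ x) := by
  rw [← mulVec_mulVec, ← mulVec_mulVec, dotProduct_mulVec, vecMul_transpose]

theorem dotProduct_mulVec_nonneg {M : Matrix ι ι ℝ} (hM : M.PosSemidef) (x : ι → ℝ) :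
    0 ≤ x ⬝ᵥ M *ᵥ x := by
  simpa using hM.dotProduct_mulVec_nonneg x

theorem dotProduct_mulVec_mono {M N : Matrix ι ι ℝ} (h : M ≤ N) (x : ι → ℝ) :
    x ⬝ᵥ M *ᵥ x ≤ x ⬝ᵥ N *ᵥ x := by
  have := dotProduct_mulVec_nonneg (Matrix.le_iff.1 h) x
  rw [sub_mulVec, dotProduct_sub] at this
  linarith

theorem exists_transpose_mul_self {M : Matrix ι ι ℝ} (hM : M.PosSemidef) [DecidableEq ι] :
    ∃ C : Matrix ι ι ℝ, M = Cᵀ * C := by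
  obtain ⟨C, hC⟩ := CStarAlgebra.nonneg_iff_eq_star_mul_self.1 (Matrix.nonneg_iff_posSemidef.2 hM)
  exact ⟨C, by simpa [star_eq_conjTranspose] using hC⟩

theorem trace_mono {M N : Matrix ι ι ℝ} (h : M ≤ N) : M.trace ≤ N.trace := by
  have := (Matrix.le_iff.1 h).trace_nonneg
  rw [trace_sub] at this
  linarith

variable [DecidableEq ι]

theorem trace_mul_nonneg {S M : Matrix ι ι ℝ} (hS : S.PosSemidef) (hM : M.PosSemidef) :
    0 ≤ (S * M).trace := by
  obtain ⟨C, hC⟩ := exists_transpose_mul_self hS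
  have h := (posSemidef_transpose_mul_mul hM Cᵀ).trace_nonneg
  rwa [transpose_transpose, trace_mul_comm, ← Matrix.mul_assoc, ← hC] at h

/-- The arithmetic-geometric mean inequality for eigenvalues, in the form `λ ≤ exp (λ - 1)`. -/
theorem det_le_exp_trace {M : Matrix ι ι ℝ} (hM : M.PosSemidef) :
    M.det ≤ Real.exp (M.trace - Fintype.card ι) := by
  rw [hM.1.det_eq_prod_eigenvalues, hM.1.trace_eq_sum_eigenvalues]
  have : (∑ i, (hM.1.eigenvalues i : ℝ)) - Fintype.card ι = ∑ i, (hM.1.eigenvalues i - 1) := by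
    simp [Finset.sum_sub_distrib]
  simp only [RCLike.ofReal_real_eq_id, id]
  rw [this, Real.exp_sum]
  refine Finset.prod_le_prod (fun i _ => hM.eigenvalues_nonneg i) fun i _ => ?_
  linarith [Real.add_one_le_exp (hM.1.eigenvalues i - 1)]

/-- The bound `det_le_exp_trace` relative to a positive definite reference matrix `X`. It compares
determinants through a trace, which is how all determinant estimates below are obtained. -/
theorem det_le_mul_exp_trace {X W : Matrix ι ι ℝ} (hX : X.PosDef) (hW : W.PosSemidef) :
    W.det ≤ X.det * Real.exp ((X⁻¹ * W).trace - Fintype.card ι) := by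
  obtain ⟨C, hC⟩ := exists_transpose_mul_self hX.posSemidef
  have hdet : X.det = C.det * C.det := by rw [hC, det_mul, det_transpose]
  have hC0 : C.det ≠ 0 := fun h => hX.det_pos.ne' (by simp [hdet, h])
  have hu : IsUnit C.det := isUnit_iff_ne_zero.2 hC0
  have h1 := det_le_exp_trace (posSemidef_transpose_mul_mul hW C⁻¹)
  have h2 : ((C⁻¹)ᵀ * W * C⁻¹).trace = (X⁻¹ * W).trace := by
    rw [trace_mul_comm, ← Matrix.mul_assoc, hC, Matrix.mul_inv_rev, transpose_nonsing_inv]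
  rw [h2, det_mul, det_mul, det_transpose, det_nonsing_inv, Ring.inverse_eq_inv'] at h1
  have h3 : W.det = X.det * (C.det⁻¹ * W.det * C.det⁻¹) := by
    rw [hdet]; field_simp
  rw [h3]
  exact mul_le_mul_of_nonneg_left h1 hX.det_pos.le

theorem trace_inv_mul_pos [Nonempty ι] {X W : Matrix ι ι ℝ} (hX : X.PosDef) (hW : W.PosDef) :
    0 < (X⁻¹ * W).trace := by
  refine lt_of_le_of_ne (trace_mul_nonneg hX.inv.posSemidef hW.posSemidef) fun h => ?_
  obtain ⟨C, hC⟩ := exists_transpose_mul_self hX.inv.posSemidef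
  have h0 : (Cᵀᵀ * W * Cᵀ).trace = 0 := by
    rw [transpose_transpose, trace_mul_comm, ← Matrix.mul_assoc, ← hC, ← h]
  rw [(posSemidef_transpose_mul_mul hW.posSemidef Cᵀ).trace_eq_zero_iff] at h0
  have := congrArg det h0
  rw [transpose_transpose, det_mul, det_mul, det_transpose, det_zero] at this
  have hd : (X⁻¹).det = C.det * C.det := by rw [hC, det_mul, det_transpose]
  have hp := hX.inv.det_pos
  have hC0 : C.det ≠ 0 := fun h => hp.ne' (by simp [hd, h])
  have hW0 := hW.det_pos.ne'
  simp [hC0, hW0] at this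

theorem det_mono {X W : Matrix ι ι ℝ} (hX : X.PosDef) (hW : W.PosSemidef) (h : W ≤ X) :
    W.det ≤ X.det := by
  have h1 := trace_mul_nonneg hX.inv.posSemidef (Matrix.le_iff.1 h)
  rw [Matrix.mul_sub, Matrix.nonsing_inv_mul _ hX.det_pos.ne'.isUnit, trace_sub, trace_one] at h1
  refine (det_le_mul_exp_trace hX hW).trans (mul_le_of_le_one_right hX.det_pos.le ?_)
  exact Real.exp_le_one_iff.2 (by linarith)

theorem det_lt_det [Nonempty ι] {X W : Matrix ι ι ℝ} (hW : W.PosSemidef) (h : (X - W).PosDef) :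
    W.det < X.det := by
  have hX : X.PosDef := by simpa using h.add_posSemidef hW
  have h1 := trace_inv_mul_pos hX h
  rw [Matrix.mul_sub, Matrix.nonsing_inv_mul _ hX.det_pos.ne'.isUnit, trace_sub, trace_one] at h1
  refine (det_le_mul_exp_trace hX hW).trans_lt (mul_lt_of_lt_one_right hX.det_pos ?_)
  rw [Real.exp_lt_one_iff]
  linarith

end PosSemidef

/-! ### Completing the square -/

section Square

variable {ι κ : Type*} [Fintype ι] [Fintype κ] [DecidableEq κ]
  (A P : Matrix ι ι ℝ) (B : Matrix ι κ ℝ) (R : Matrix κ κ ℝ) (K : Matrix κ ι ℝ)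

/-- One-step cost-to-go matrix of the feedback `u = K x`, when the control is delivered and the
future cost is `xᵀ P x`. -/
def closedLoop : Matrix ι ι ℝ := (A + B * K)ᵀ * P * (A + B * K) + Kᵀ * R * K

/-- The feedback gain that minimizes `closedLoop`. -/
noncomputable def optGain : Matrix κ ι ℝ := -((Bᵀ * P * B + R)⁻¹ * (Bᵀ * P * A))

/-- The reduction of `P` that one delivered optimal control achieves. -/
noncomputable def reduction : Matrix ι ι ℝ := P * B * (Bᵀ * P * B + R)⁻¹ * (Bᵀ * P)

variable {A P B R K}

/-- Completion of the square in the gain `K`. Only invertibility is asked of the weight, so that the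
case `R = 0` is covered. -/
theorem closedLoop_eq (hP : Pᵀ = P) (hR : Rᵀ = R) (h : IsUnit (Bᵀ * P * B + R).det) :
    closedLoop A P B R K = Aᵀ * (P - reduction P B R) * A
      + (K - optGain A P B R)ᵀ * (Bᵀ * P * B + R) * (K - optGain A P B R) := by
  set S := Bᵀ * P * B + R with hS
  have hSt : Sᵀ = S := by simp [hS, hP, hR, Matrix.mul_assoc]
  have hSi : S⁻¹ᵀ = S⁻¹ := by rw [transpose_nonsing_inv, hSt]
  set N := Bᵀ * P * A with hN
  have hNt : Nᵀ = Aᵀ * P * B := by simp [hN, hP, Matrix.mul_assoc]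
  have e1 : closedLoop A P B R K = Aᵀ * P * A + Nᵀ * K + Kᵀ * N + Kᵀ * S * K := by
    rw [hNt]
    simp only [closedLoop, hN, hS, transpose_add, transpose_mul, Matrix.add_mul, Matrix.mul_add,
      Matrix.mul_assoc]
    abel
  have e2 : Aᵀ * (P - reduction P B R) * A = Aᵀ * P * A - Nᵀ * S⁻¹ * N := by
    rw [hNt, reduction, ← hS]
    simp only [hN, Matrix.sub_mul, Matrix.mul_sub, Matrix.mul_assoc]
  have e3 : K - optGain A P B R = K + S⁻¹ * N := by simp [optGain, ← hS, ← hN]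
  have e4 : (K + S⁻¹ * N)ᵀ * S * (K + S⁻¹ * N) = Kᵀ * S * K + Kᵀ * (S * S⁻¹) * N
      + Nᵀ * (S⁻¹ * S) * K + Nᵀ * (S⁻¹ * S) * S⁻¹ * N := by
    rw [transpose_add, transpose_mul, hSi]
    simp only [Matrix.add_mul, Matrix.mul_add, Matrix.mul_assoc]
    abel
  rw [e1, e2, e3, e4, Matrix.mul_nonsing_inv _ h, Matrix.nonsing_inv_mul _ h]
  simp only [Matrix.mul_one]
  abel

theorem closedLoop_optGain (hP : Pᵀ = P) (hR : Rᵀ = R) (h : IsUnit (Bᵀ * P * B + R).det) :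
    closedLoop A P B R (optGain A P B R) = Aᵀ * (P - reduction P B R) * A := by
  simp [closedLoop_eq hP hR h]

theorem reduction_step_le (hP : Pᵀ = P) (hR : Rᵀ = R) (h : (Bᵀ * P * B + R).PosDef) :
    Aᵀ * (P - reduction P B R) * A ≤ closedLoop A P B R K := by
  rw [closedLoop_eq hP hR h.det_pos.ne'.isUnit, Matrix.le_iff, add_sub_cancel_left]
  exact posSemidef_transpose_mul_mul h.posSemidef _

end Square

/-! ### Factorization of a semidefinite matrix through its range -/

section Factor

variable {ι κ : Type*} [Fintype ι] [Fintype κ]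

/-- A positive semidefinite matrix is `Fᵀ F` for a matrix `F` with a right inverse. The rows of `F`
are the eigenvectors of the positive eigenvalues, scaled. -/
theorem exists_transpose_mul_self_surjective {ι : Type} [Fintype ι] [DecidableEq ι]
    {M : Matrix ι ι ℝ} (hM : M.PosSemidef) :
    ∃ (κ : Type) (_ : Fintype κ) (_ : DecidableEq κ) (F : Matrix κ ι ℝ) (G : Matrix ι κ ℝ),
      F * G = 1 ∧ M = Fᵀ * F := by
  classical
  set U : Matrix ι ι ℝ := (hM.1.eigenvectorUnitary : Matrix ι ι ℝ) with hU
  have hUU : Uᵀ * U = 1 := by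
    have := Unitary.coe_star_mul_self hM.1.eigenvectorUnitary
    simpa [star_eq_conjTranspose] using this
  set d := hM.1.eigenvalues with hd
  have hd0 : ∀ i, 0 ≤ d i := hM.eigenvalues_nonneg
  have hspec : M = U * diagonal d * Uᵀ := by
    have := hM.1.spectral_theorem
    rw [Unitary.conjStarAlgAut_apply] at this
    simpa [star_eq_conjTranspose] using this
  refine ⟨{i // d i ≠ 0}, inferInstance, inferInstance, Matrix.of fun i j => √(d i) * U j i,
    Matrix.of fun j i => U j i * (√(d i))⁻¹, ?_, ?_⟩
  · ext i k
    have h1 := congrFun (congrFun hUU i) k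
    rw [Matrix.mul_apply] at h1 ⊢
    simp only [of_apply, transpose_apply] at h1 ⊢
    have : ∀ j, √(d i) * U j i * (U j k * (√(d k))⁻¹)
        = √(d i) * (√(d k))⁻¹ * (U j i * U j k) := fun j => by ring
    simp_rw [this]
    rw [← Finset.mul_sum, h1]
    by_cases hik : i = k
    · subst hik
      have : √(d i) ≠ 0 := by
        rw [Real.sqrt_ne_zero (hd0 i)]; exact i.2
      simp [this]
    · have : (i : ι) ≠ k := fun h => hik (Subtype.ext h)
      simp [hik, this]
  · ext j k
    rw [hspec, Matrix.mul_apply, Matrix.mul_apply]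
    simp only [mul_diagonal, transpose_apply, of_apply]
    have hsub : ∀ i, √(d i) * U j i * (√(d i) * U k i) = U j i * d i * U k i := fun i => by
      calc _ = U j i * (√(d i) * √(d i)) * U k i := by ring
        _ = _ := by rw [Real.mul_self_sqrt (hd0 i)]
    simp_rw [hsub]
    rw [← Fintype.sum_subtype_add_sum_subtype (fun i => d i ≠ 0)
      (fun i => U j i * d i * U k i), add_eq_left]
    refine Finset.sum_eq_zero fun i _ => ?_
    have := not_not.1 i.2
    simp [this]

theorem eq_zero_of_gram_le {P : Matrix κ ι ℝ} (h : Pᵀ * P ≤ 0) : P = 0 := by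
  have h1 : (Pᵀ * P).trace = 0 := by
    refine le_antisymm (by simpa using trace_mono h) ?_
    simpa using (posSemidef_conjTranspose_mul_self P).trace_nonneg
  exact trace_conjTranspose_mul_self_eq_zero_iff.1 (by simpa using h1)

/-- Every matrix factors through an orthonormal basis, the columns of `U`, of its range. -/
theorem exists_orthonormal_columns {μ : Type} [Fintype μ] [DecidableEq μ] (B : Matrix κ μ ℝ) :
    ∃ (s : Type) (_ : Fintype s) (_ : DecidableEq s) (U : Matrix κ s ℝ) (V : Matrix s μ ℝ)
      (C : Matrix μ s ℝ), Uᵀ * U = 1 ∧ B = U * V ∧ U = B * C := by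
  obtain ⟨s, hs, hs', F, G, hFG, hB⟩ :=
    exists_transpose_mul_self_surjective (M := Bᵀ * B)
      (by simpa using posSemidef_conjTranspose_mul_self B)
  refine ⟨s, hs, hs', B * G, F, G, ?_, ?_, rfl⟩
  · rw [transpose_mul, Matrix.mul_assoc, ← Matrix.mul_assoc Bᵀ, hB, Matrix.mul_assoc, hFG,
      Matrix.mul_one, ← transpose_mul, hFG, transpose_one]
  · have hF : F * (1 - G * F) = 0 := by
      rw [Matrix.mul_sub, ← Matrix.mul_assoc, hFG, Matrix.one_mul, Matrix.mul_one, sub_self]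
    have : B * (1 - G * F) = 0 := by
      refine eq_zero_of_gram_le (le_of_eq ?_)
      rw [transpose_mul, Matrix.mul_assoc, ← Matrix.mul_assoc Bᵀ, hB, Matrix.mul_assoc, hF,
        Matrix.mul_zero, Matrix.mul_zero]
    rw [Matrix.mul_sub, Matrix.mul_one, sub_eq_zero, ← Matrix.mul_assoc] at this
    exact this

end Factor

/-! ### Obstructions to stabilization -/

section Obstruction

variable {ι : Type} {μ : Type*} [Fintype ι] [DecidableEq ι]

/-- The directions in which `M` is degenerate are invariant under `A`, and the inequalities descend
to the quotient by them, where `M` becomes the identity. -/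
theorem exists_quotient {A M X : Matrix ι ι ℝ} {B : Matrix ι μ ℝ} {ρ : ℝ} (hρ : 0 ≤ ρ)
    (hM : M.PosSemidef) (hM0 : M ≠ 0) (hX : X.PosSemidef)
    (h1 : M ≤ Aᵀ * (M - ρ • X) * A) (h2 : X ≤ Aᵀ * M * A) (h3 : Bᵀ * M * B ≤ Bᵀ * X * B) :
    ∃ (κ : Type) (_ : Fintype κ) (_ : DecidableEq κ) (_ : Nonempty κ) (F : Matrix κ ι ℝ)
      (G : Matrix ι κ ℝ) (A' X' : Matrix κ κ ℝ),
      F * G = 1 ∧ F * A = A' * F ∧ X'.PosSemidef ∧ 1 ≤ A'ᵀ * (1 - ρ • X') * A' ∧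
        (F * B)ᵀ * (F * B) ≤ (F * B)ᵀ * X' * (F * B) := by
  obtain ⟨κ, hκ, hκ', F, G, hFG, hF⟩ := exists_transpose_mul_self_surjective hM
  have hne : Nonempty κ := by
    by_contra h
    rw [not_nonempty_iff] at h
    exact hM0 (by rw [hF, Subsingleton.elim F 0]; simp)
  -- `F` identifies the quotient with `κ`; since `M = Fᵀ F` grows under `A`, `F A` factors through `F`.
  have hMA : M ≤ Aᵀ * M * A := by
    refine h1.trans (transpose_mul_mul_mono ?_ A)
    rw [Matrix.le_iff, sub_sub_cancel]
    exact hX.smul hρ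
  obtain ⟨T, hT⟩ : ∃ T, T = F * A := ⟨_, rfl⟩
  have hTT : Aᵀ * M * A = Tᵀ * T := by
    rw [hF, hT, transpose_mul]; simp only [Matrix.mul_assoc]
  rw [hTT] at hMA h2
  rw [hF] at hMA
  have hGF : Gᵀ * Fᵀ = 1 := by rw [← transpose_mul, hFG, transpose_one]
  obtain ⟨A', hA'⟩ : ∃ A', A' = T * G := ⟨_, rfl⟩
  have hA1 : 1 ≤ A'ᵀ * A' := by
    have := transpose_mul_mul_mono hMA G
    rw [← Matrix.mul_assoc, hGF, Matrix.one_mul, hFG] at this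
    rw [hA', transpose_mul, Matrix.mul_assoc, ← Matrix.mul_assoc Tᵀ, ← Matrix.mul_assoc]
    exact this
  have hAu : IsUnit A'.det := by
    have h := det_mono (X := A'ᵀ * A') (W := 1) ?_ PosSemidef.one hA1
    · rw [det_mul, det_transpose, det_one] at h
      refine isUnit_iff_ne_zero.2 fun h0 => ?_
      rw [h0] at h; norm_num at h
    · have := (PosDef.one (n := κ) (R := ℝ)).add_posSemidef (Matrix.le_iff.1 hA1)
      rwa [add_sub_cancel] at this
  have hFA : T = A' * F := by
    have hTY : T * (1 - G * A'⁻¹ * T) = 0 := by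
      rw [Matrix.mul_sub, Matrix.mul_one, ← Matrix.mul_assoc, ← Matrix.mul_assoc, ← hA',
        Matrix.mul_nonsing_inv _ hAu, Matrix.one_mul, sub_self]
    have hFY : F * (1 - G * A'⁻¹ * T) = 0 := by
      refine eq_zero_of_gram_le ?_
      have := transpose_mul_mul_mono hMA (1 - G * A'⁻¹ * T)
      rw [Matrix.mul_assoc _ (Tᵀ * T), Matrix.mul_assoc Tᵀ, hTY, Matrix.mul_zero,
        Matrix.mul_zero, ← Matrix.mul_assoc, ← transpose_mul, Matrix.mul_assoc] at this
      exact this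
    rw [Matrix.mul_sub, Matrix.mul_one, ← Matrix.mul_assoc, ← Matrix.mul_assoc, hFG,
      Matrix.one_mul, sub_eq_zero] at hFY
    rw [hFY, ← Matrix.mul_assoc, Matrix.mul_nonsing_inv _ hAu, Matrix.one_mul]
  -- `1 - G F` projects onto the kernel of `F`, where `X` vanishes because `X ≤ Aᵀ M A`.
  have hXZ : X * (1 - G * F) = 0 := by
    have hFZ : F * (1 - G * F) = 0 := by
      rw [Matrix.mul_sub, ← Matrix.mul_assoc, hFG, Matrix.one_mul, Matrix.mul_one, sub_self]
    have h := transpose_mul_mul_mono h2 (1 - G * F)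
    have hz : (1 - G * F)ᵀ * (Tᵀ * T) * (1 - G * F) = 0 := by
      rw [Matrix.mul_assoc, Matrix.mul_assoc, hFA, Matrix.mul_assoc A', hFZ]; simp
    rw [hz] at h
    obtain ⟨C, hC⟩ := exists_transpose_mul_self hX
    have hC0 : C * (1 - G * F) = 0 := by
      refine eq_zero_of_gram_le ?_
      rw [hC] at h
      rw [transpose_mul]
      simpa only [Matrix.mul_assoc] using h
    rw [hC, Matrix.mul_assoc, hC0, Matrix.mul_zero]
  have hXF : Fᵀ * (Gᵀ * X * G) * F = X := by
    rw [Matrix.mul_sub, Matrix.mul_one, sub_eq_zero] at hXZ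
    have hXt : Xᵀ = X := by simpa using hX.1.eq
    have hXZ' : Fᵀ * Gᵀ * X = X := by
      have := congrArg transpose hXZ
      rw [transpose_mul, transpose_mul, hXt] at this
      exact this.symm
    calc Fᵀ * (Gᵀ * X * G) * F = Fᵀ * Gᵀ * X * (G * F) := by simp only [Matrix.mul_assoc]
      _ = X := by rw [hXZ', ← hXZ]
  refine ⟨κ, hκ, hκ', hne, F, G, A', Gᵀ * X * G, hFG, hT ▸ hFA, posSemidef_transpose_mul_mul hX G,
    ?_, ?_⟩
  · have h := transpose_mul_mul_mono h1 G
    have e1 : Gᵀ * M * G = 1 := by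
      rw [hF, ← Matrix.mul_assoc, hGF, Matrix.one_mul, hFG]
    have e2 : M - ρ • X = Fᵀ * (1 - ρ • (Gᵀ * X * G)) * F := by
      rw [Matrix.mul_sub, Matrix.sub_mul, Matrix.mul_one, ← hF, Matrix.mul_smul, Matrix.smul_mul,
        hXF]
    rw [e1, e2] at h
    refine h.trans (le_of_eq ?_)
    rw [hA', hT]
    simp only [transpose_mul, Matrix.mul_assoc]
  · have e1 : (F * B)ᵀ * (F * B) = Bᵀ * M * B := by
      rw [hF, transpose_mul]; simp only [Matrix.mul_assoc]
    have e2 : (F * B)ᵀ * (Gᵀ * X * G) * (F * B) = Bᵀ * X * B := by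
      conv_rhs => rw [← hXF]
      rw [transpose_mul]; simp only [Matrix.mul_assoc]
    rw [e1, e2]; exact h3

variable {κ s : Type} [Fintype κ] [DecidableEq κ] [Fintype s] [DecidableEq s]

theorem compl_projection_gram {U : Matrix κ s ℝ} (hU : Uᵀ * U = 1) :
    (1 - U * Uᵀ)ᵀ * (1 - U * Uᵀ) = 1 - U * Uᵀ := by
  have : U * Uᵀ * (U * Uᵀ) = U * Uᵀ := by
    rw [Matrix.mul_assoc, ← Matrix.mul_assoc Uᵀ, hU, Matrix.one_mul]
  rw [transpose_sub, transpose_mul, transpose_transpose, transpose_one, Matrix.mul_sub,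
    Matrix.mul_one, Matrix.sub_mul, this, Matrix.one_mul, sub_self, sub_zero]

theorem posDef_one_sub_smul {U : Matrix κ s ℝ} (hU : Uᵀ * U = 1) {ρ : ℝ} (hρ : 0 ≤ ρ)
    (hρ1 : ρ < 1) : (1 - ρ • (U * Uᵀ)).PosDef := by
  have h2 : (1 - U * Uᵀ).PosSemidef := by
    rw [← compl_projection_gram hU, ← conjTranspose_eq_transpose_of_trivial]
    exact posSemidef_conjTranspose_mul_self _
  have h3 := ((PosDef.one (n := κ) (R := ℝ)).smul (sub_pos.2 hρ1)).add_posSemidef (h2.smul hρ)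
  convert h3 using 1
  module

theorem det_one_sub_smul {U : Matrix κ s ℝ} (hU : Uᵀ * U = 1) (ρ : ℝ) :
    (1 - ρ • (U * Uᵀ)).det = (1 - ρ) ^ Fintype.card s := by
  rw [← Matrix.smul_mul, det_one_sub_mul_comm, Matrix.mul_smul, hU]
  have : (1 : Matrix s s ℝ) - ρ • 1 = (1 - ρ) • 1 := by module
  rw [this, det_smul, det_one, mul_one]

/-- If `X` is at least the identity on the range of `U`, then `1 - ρ X` has at most the
determinant that it has when `X` is the projection onto this range. -/
theorem det_one_sub_le {U : Matrix κ s ℝ} (hU : Uᵀ * U = 1) {X : Matrix κ κ ℝ} (hX : X.PosSemidef)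
    (hUX : 1 ≤ Uᵀ * X * U) {ρ : ℝ} (hρ : 0 ≤ ρ) (hρ1 : ρ < 1) (hK : (1 - ρ • X).PosSemidef) :
    (1 - ρ • X).det ≤ (1 - ρ) ^ Fintype.card s := by
  have hr : (1 - ρ) ≠ 0 := (sub_pos.2 hρ1).ne'
  have hD := posDef_one_sub_smul hU hρ hρ1
  have hinv : (1 - ρ • (U * Uᵀ))⁻¹ = 1 + (ρ / (1 - ρ)) • (U * Uᵀ) := by
    refine Matrix.inv_eq_right_inv ?_
    have : U * Uᵀ * (U * Uᵀ) = U * Uᵀ := by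
      rw [Matrix.mul_assoc, ← Matrix.mul_assoc Uᵀ, hU, Matrix.one_mul]
    rw [Matrix.sub_mul, Matrix.one_mul, Matrix.mul_add, Matrix.mul_one, Matrix.smul_mul,
      Matrix.mul_smul, this, smul_smul, add_sub_assoc, add_eq_left, ← sub_sub, ← sub_smul,
      ← sub_smul]
    rw [show ρ / (1 - ρ) - ρ - ρ * (ρ / (1 - ρ)) = 0 by field_simp; ring, zero_smul]
  have htU : (U * Uᵀ).trace = Fintype.card s := by rw [trace_mul_comm, hU, trace_one]
  have ht1 : (Fintype.card s : ℝ) ≤ (U * Uᵀ * X).trace := by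
    have := trace_mono hUX
    rwa [trace_one, Matrix.mul_assoc, trace_mul_comm, Matrix.mul_assoc, trace_mul_comm] at this
  -- Compressing `X` to the range of `U` only loses the trace on the complement.
  have ht2 : (U * Uᵀ * X).trace ≤ X.trace := by
    have h1 : (0 : ℝ) ≤ ((1 - U * Uᵀ)ᵀ * X * (1 - U * Uᵀ)).trace :=
      (posSemidef_transpose_mul_mul hX _).trace_nonneg
    have hidem : (1 - U * Uᵀ) * (1 - U * Uᵀ)ᵀ = 1 - U * Uᵀ := by
      have h := compl_projection_gram hU
      have ht : (1 - U * Uᵀ)ᵀ = 1 - U * Uᵀ := by simp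
      rwa [ht] at h ⊢
    rw [trace_mul_comm, ← Matrix.mul_assoc, hidem, Matrix.sub_mul, trace_sub, Matrix.one_mul] at h1
    linarith
  have h := det_le_mul_exp_trace hD hK
  rw [det_one_sub_smul hU] at h
  refine h.trans (mul_le_of_le_one_right (pow_nonneg (sub_pos.2 hρ1).le _) ?_)
  rw [Real.exp_le_one_iff, hinv]
  have : ((1 + (ρ / (1 - ρ)) • (U * Uᵀ)) * (1 - ρ • X)).trace = Fintype.card κ
      + (ρ / (1 - ρ)) * Fintype.card s - ρ * X.trace - ρ / (1 - ρ) * ρ * (U * Uᵀ * X).trace := by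
    rw [Matrix.add_mul, Matrix.mul_sub, Matrix.mul_sub, Matrix.mul_one, Matrix.mul_one,
      Matrix.one_mul, Matrix.smul_mul, Matrix.mul_smul, trace_add, trace_sub, trace_sub, trace_one,
      trace_smul, trace_smul, trace_smul, trace_smul, htU]
    simp only [smul_eq_mul]
    ring
  rw [this]
  have h4 : ρ * Fintype.card s ≤ ρ * X.trace := mul_le_mul_of_nonneg_left (ht1.trans ht2) hρ
  have h5 : ρ / (1 - ρ) * ρ * Fintype.card s ≤ ρ / (1 - ρ) * ρ * (U * Uᵀ * X).trace :=
    mul_le_mul_of_nonneg_left ht1 (mul_nonneg (div_nonneg hρ (sub_pos.2 hρ1).le) hρ)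
  have h6 : ρ / (1 - ρ) * (Fintype.card s : ℝ) - ρ * Fintype.card s
      - ρ / (1 - ρ) * ρ * Fintype.card s = 0 := by field_simp; ring
  linarith

/-- If `A` expands every vector even after the loss `ρ X`, where `X` is at least the identity on the
range of `U`, then `|det A|` is large. This and `det_sq_mul_lt_one` are the two sides of the contradiction that bounds the Riccati recursion. -/
theorem one_le_det_sq_mul {A X : Matrix κ κ ℝ} {U : Matrix κ s ℝ} (hU : Uᵀ * U = 1)
    (hX : X.PosSemidef) (hUX : 1 ≤ Uᵀ * X * U) {ρ : ℝ} (hρ : 0 ≤ ρ) (hρ1 : ρ < 1)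
    (h : 1 ≤ Aᵀ * (1 - ρ • X) * A) : 1 ≤ A.det ^ 2 * (1 - ρ) ^ Fintype.card s := by
  have hpd : (Aᵀ * (1 - ρ • X) * A).PosDef := by
    have := (PosDef.one (n := κ) (R := ℝ)).add_posSemidef (Matrix.le_iff.1 h)
    rwa [add_sub_cancel] at this
  have h1 := det_mono hpd PosSemidef.one h
  have h2 : (Aᵀ * (1 - ρ • X) * A).det = A.det ^ 2 * (1 - ρ • X).det := by
    rw [det_mul, det_mul, det_transpose]; ring
  rw [h2, det_one] at h1
  have hA : IsUnit A.det := by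
    refine isUnit_iff_ne_zero.2 fun h0 => ?_
    rw [h0] at h1; norm_num at h1
  have hK : (1 - ρ • X).PosSemidef := by
    have := posSemidef_transpose_mul_mul hpd.posSemidef A⁻¹
    rwa [Matrix.mul_assoc, Matrix.mul_assoc, Matrix.mul_nonsing_inv _ hA, Matrix.mul_one,
      ← Matrix.mul_assoc, ← transpose_mul, Matrix.mul_nonsing_inv _ hA, transpose_one,
      Matrix.one_mul] at this
  exact h1.trans (mul_le_mul_of_nonneg_left (det_one_sub_le hU hX hUX hρ hρ1 hK) (sq_nonneg _))

/-- Closed loops that contract `X` on average, when a control with values in the range of `U` is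
delivered with probability `ρ`, bound the determinant of `A`. -/
theorem det_sq_mul_lt_one [Nonempty κ] {A X : Matrix κ κ ℝ} {U : Matrix κ s ℝ} (hU : Uᵀ * U = 1)
    (hX : X.PosDef) {L : Matrix s κ ℝ} {ρ : ℝ} (hρ : 0 ≤ ρ) (hρ1 : ρ ≤ 1)
    (h : (X - ((1 - ρ) • (Aᵀ * X * A) + ρ • ((A + U * L)ᵀ * X * (A + U * L)))).PosDef) :
    A.det ^ 2 * (1 - ρ) ^ Fintype.card s < 1 := by
  have hUi : Function.Injective U.mulVec := by
    intro x y hxy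
    have := congrArg (Uᵀ.mulVec) hxy
    simpa [hU] using this
  have hG : (Uᵀ * X * U + 0).PosDef := by
    simpa using hX.conjTranspose_mul_mul_same hUi
  have hXt : Xᵀ = X := by simpa using hX.1.eq
  -- The best feedback with values in the range of `U` is that of zero control weight.
  have hle : Aᵀ * (X - reduction X U 0) * A ≤ (A + U * L)ᵀ * X * (A + U * L) := by
    have := reduction_step_le (A := A) (K := L) hXt transpose_zero hG
    simpa [closedLoop] using this
  have hred : (X - reduction X U 0).PosSemidef := by
    have h1 := closedLoop_optGain (A := 1) hXt transpose_zero hG.det_pos.ne'.isUnit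
    rw [transpose_one, Matrix.one_mul, Matrix.mul_one] at h1
    rw [← h1, closedLoop, Matrix.mul_zero, Matrix.zero_mul, add_zero]
    exact posSemidef_transpose_mul_mul hX.posSemidef _
  set W := Aᵀ * (X - ρ • reduction X U 0) * A with hW
  have hW2 : W = (1 - ρ) • (Aᵀ * X * A) + ρ • (Aᵀ * (X - reduction X U 0) * A) := by
    rw [hW]
    simp only [Matrix.mul_sub, Matrix.sub_mul, Matrix.mul_smul, Matrix.smul_mul]
    module
  have hWle : W ≤ (1 - ρ) • (Aᵀ * X * A) + ρ • ((A + U * L)ᵀ * X * (A + U * L)) := by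
    rw [hW2, Matrix.le_iff, add_sub_add_left_eq_sub, ← smul_sub]
    exact (Matrix.le_iff.1 hle).smul hρ
  have hWp : W.PosSemidef := by
    rw [hW2]
    exact ((posSemidef_transpose_mul_mul hX.posSemidef A).smul (sub_nonneg.2 hρ1)).add
      ((posSemidef_transpose_mul_mul hred A).smul hρ)
  have hlt := det_lt_det hWp (X := X) (by
    have := h.add_posSemidef (Matrix.le_iff.1 hWle)
    rwa [sub_add_sub_cancel] at this)
  have hdet : W.det = A.det ^ 2 * (X.det * (1 - ρ) ^ Fintype.card s) := by
    have e1 : X - ρ • reduction X U 0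
        = X * (1 - (ρ • U) * ((Uᵀ * X * U + 0)⁻¹ * (Uᵀ * X))) := by
      rw [Matrix.mul_sub, Matrix.mul_one, reduction, Matrix.smul_mul, Matrix.mul_smul]
      simp only [Matrix.mul_assoc]
    have e2 : (1 : Matrix s s ℝ) - ρ • 1 = (1 - ρ) • 1 := by module
    rw [hW, det_mul, det_mul, det_transpose, e1, det_mul, det_one_sub_mul_comm, Matrix.mul_smul,
      Matrix.mul_assoc, ← add_zero (Uᵀ * X * U), add_zero (Uᵀ * X * U + 0),
      Matrix.nonsing_inv_mul _ hG.det_pos.ne'.isUnit, e2, det_smul, det_one]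
    ring
  rw [hdet] at hlt
  have := hX.det_pos
  by_contra hc
  have h3 : X.det * 1 ≤ X.det * (A.det ^ 2 * (1 - ρ) ^ Fintype.card s) :=
    mul_le_mul_of_nonneg_left (not_lt.1 hc) this.le
  nlinarith

end Obstruction

/-! ### Limits of semidefinite matrices -/

section Limits

variable {ι κ : Type*} [Fintype ι] [Fintype κ]

theorem posSemidef_of_forall {M : Matrix ι ι ℝ} (hM : Mᵀ = M) (h : ∀ x, 0 ≤ x ⬝ᵥ M *ᵥ x) :
    M.PosSemidef :=
  .of_dotProduct_mulVec_nonneg (by simpa [IsHermitian] using hM) (by simpa using h)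

theorem posSemidef_of_tendsto {M : ℕ → Matrix ι ι ℝ} {L : Matrix ι ι ℝ}
    (h : Tendsto M atTop (nhds L)) (hM : ∀ k, (M k).PosSemidef) : L.PosSemidef := by
  refine posSemidef_of_forall ?_ fun x => ?_
  · refine tendsto_nhds_unique ((continuous_id.matrix_transpose.tendsto L).comp h) ?_
    refine h.congr fun k => ?_
    simpa using (hM k).1.eq.symm
  · have hc : Continuous fun N : Matrix ι ι ℝ => x ⬝ᵥ N *ᵥ x := by fun_prop
    exact ge_of_tendsto' ((hc.tendsto L).comp h) fun k => dotProduct_mulVec_nonneg (hM k) x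

theorem le_of_tendsto_matrix {M N : ℕ → Matrix ι ι ℝ} {L L' : Matrix ι ι ℝ}
    (hM : Tendsto M atTop (nhds L)) (hN : Tendsto N atTop (nhds L')) (h : ∀ k, M k ≤ N k) :
    L ≤ L' :=
  Matrix.le_iff.2 (posSemidef_of_tendsto (hN.sub hM) fun k => Matrix.le_iff.1 (h k))

theorem abs_apply_le_trace [DecidableEq ι] {M : Matrix ι ι ℝ} (hM : M.PosSemidef) (i j : ι) :
    |M i j| ≤ M.trace := by
  have hd : ∀ k, 0 ≤ M k k := fun k => hM.diag_nonneg
  have hle : ∀ k, M k k ≤ M.trace := fun k =>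
    Finset.single_le_sum (f := fun k => M k k) (fun k _ => hd k) (Finset.mem_univ k)
  have hs : M j i = M i j := by simpa using congrFun (congrFun hM.1.eq i) j
  have key : ∀ c : ℝ, 0 ≤ M i i + 2 * c * M i j + c ^ 2 * M j j := fun c => by
    have h := dotProduct_mulVec_nonneg hM (Pi.single i 1 + c • Pi.single j 1)
    simp [mulVec_add, mulVec_smul, add_dotProduct, dotProduct_add, hs] at h
    nlinarith
  have h1 := key 1
  have h2 := key (-1)
  have := hle i
  have := hle j
  rw [abs_le]
  constructor <;> linarith

/-- Bounded traces suffice for compactness, as they bound the entries. -/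
theorem exists_tendsto_subseq [DecidableEq ι] {M : ℕ → Matrix ι ι ℝ} (hM : ∀ k, (M k).PosSemidef)
    {c : ℝ} (hc : ∀ k, (M k).trace ≤ c) :
    ∃ (L : Matrix ι ι ℝ) (φ : ℕ → ℕ), StrictMono φ ∧ Tendsto (fun k => M (φ k)) atTop (nhds L) := by
  have hcomp : IsCompact (Set.univ.pi fun _ : ι => Set.univ.pi fun _ : ι => Set.Icc (-c) c) :=
    isCompact_univ_pi fun _ => isCompact_univ_pi fun _ => isCompact_Icc
  obtain ⟨L, -, φ, hφ, hL⟩ := hcomp.tendsto_subseq (x := fun k i j => M k i j) fun k i _ j _ =>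
    abs_le.1 ((abs_apply_le_trace (hM k) i j).trans (hc k))
  exact ⟨L, φ, hφ, hL⟩

/-- Monotone sequences of positive semidefinite matrices with bounded traces converge. -/
theorem exists_tendsto_of_monotone [DecidableEq ι] {M : ℕ → Matrix ι ι ℝ}
    (h0 : ∀ k, (M k).PosSemidef) (hmono : Monotone M) {c : ℝ} (hc : ∀ k, (M k).trace ≤ c) :
    ∃ L : Matrix ι ι ℝ, L.PosSemidef ∧ Tendsto M atTop (nhds L) := by
  obtain ⟨L, φ, hφ, hL⟩ := exists_tendsto_subseq h0 hc
  have hle : ∀ k, M k ≤ L := fun k => by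
    have h1 : Tendsto (fun j => M (φ (j + k))) atTop (nhds L) :=
      hL.comp (tendsto_add_atTop_nat k)
    refine le_of_tendsto_matrix tendsto_const_nhds h1 fun j => hmono ?_
    exact (Nat.le_add_left k j).trans (hφ.id_le _)
  refine ⟨L, posSemidef_of_tendsto hL fun k => h0 _, ?_⟩
  have htr : Tendsto (fun k => (L - M k).trace) atTop (nhds 0) := by
    have hanti : Antitone fun k => (L - M k).trace := fun j k hjk =>
      trace_mono (sub_le_sub_left (hmono hjk) L)
    have hsub : Tendsto (fun k => (L - M (φ k)).trace) atTop (nhds 0) := by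
      have hcont : Continuous fun N : Matrix ι ι ℝ => (L - N).trace := by fun_prop
      have := (hcont.tendsto L).comp hL
      rwa [sub_self, trace_zero] at this
    refine tendsto_order.2 ⟨fun a ha => ?_, fun a ha => ?_⟩
    · exact Eventually.of_forall fun k => ha.trans_le (Matrix.le_iff.1 (hle k)).trace_nonneg
    · obtain ⟨k, hk⟩ := ((tendsto_order.1 hsub).2 a ha).exists
      exact eventually_atTop.2 ⟨φ k, fun j hj => (hanti hj).trans_lt hk⟩
  have hz : Tendsto (fun k => L - M k) atTop (nhds 0) := by
    refine tendsto_pi_nhds.2 fun i => tendsto_pi_nhds.2 fun j => ?_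
    exact squeeze_zero_norm (fun k => abs_apply_le_trace (Matrix.le_iff.1 (hle k)) i j) htr
  simpa using (tendsto_const_nhds (x := L)).sub hz

/-- If the matrices `M k` of a Riccati-type recursion are unbounded, then the limit of a normalized
subsequence satisfies the homogeneous inequalities. -/
theorem exists_homogeneous_of_unbounded [DecidableEq ι] {M X : ℕ → Matrix ι ι ℝ}
    {A Q : Matrix ι ι ℝ} {B : Matrix ι κ ℝ} {R : Matrix κ κ ℝ} {ρ : ℝ}
    (hM : ∀ k, (M k).PosSemidef) (hX : ∀ k, (X k).PosSemidef)
    (h1 : ∀ k, M k ≤ Q + Aᵀ * (M k - ρ • X k) * A) (h2 : ∀ k, X k ≤ Q + Aᵀ * M k * A)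
    (h3 : ∀ k, Bᵀ * M k * B ≤ Bᵀ * X k * B + R) (hub : ∀ c, ∃ k, c < (M k).trace) :
    ∃ M' X' : Matrix ι ι ℝ, M'.PosSemidef ∧ M' ≠ 0 ∧ X'.PosSemidef ∧
      M' ≤ Aᵀ * (M' - ρ • X') * A ∧ X' ≤ Aᵀ * M' * A ∧ Bᵀ * M' * B ≤ Bᵀ * X' * B := by
  choose f hf using fun j : ℕ => hub (j + 1)
  set t : ℕ → ℝ := fun j => ((M (f j)).trace)⁻¹ with ht
  have htr : ∀ j, 0 < (M (f j)).trace := fun j => by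
    have : (0 : ℝ) ≤ j := j.cast_nonneg
    linarith [hf j]
  have htpos : ∀ j, 0 ≤ t j := fun j => (inv_pos.2 (htr j)).le
  have ht0 : Tendsto t atTop (nhds 0) := by
    refine squeeze_zero htpos (fun j => ?_) (tendsto_one_div_add_atTop_nhds_zero_nat (𝕜 := ℝ))
    rw [one_div]
    exact inv_anti₀ (by positivity) (hf j).le
  have hN : ∀ j, (t j • M (f j)).PosSemidef := fun j => (hM _).smul (htpos j)
  have hNtr : ∀ j, (t j • M (f j)).trace = 1 := fun j => by
    rw [trace_smul, smul_eq_mul, ht]; exact inv_mul_cancel₀ (htr j).ne'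
  obtain ⟨M', φ, hφ, hM'⟩ := exists_tendsto_subseq hN fun j => (hNtr j).le
  have hQ0 : Tendsto (fun j => t (φ j) • Q) atTop (nhds 0) := by
    simpa using (ht0.comp hφ.tendsto_atTop).smul_const Q
  have hlim : Tendsto (fun j => t (φ j) • Q + Aᵀ * (t (φ j) • M (f (φ j))) * A) atTop
      (nhds (0 + Aᵀ * M' * A)) := by
    have hc : Continuous fun N : Matrix ι ι ℝ => Aᵀ * N * A := by fun_prop
    exact hQ0.add ((hc.tendsto M').comp hM')
  have h2' : ∀ j, t (φ j) • X (f (φ j))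
      ≤ t (φ j) • Q + Aᵀ * (t (φ j) • M (f (φ j))) * A := fun j => by
    have := (Matrix.le_iff.1 (h2 (f (φ j)))).smul (htpos (φ j))
    rw [Matrix.le_iff]
    convert this using 1
    simp only [Matrix.mul_smul, Matrix.smul_mul, smul_sub, smul_add]
  have hct : Continuous fun N : Matrix ι ι ℝ => N.trace := by fun_prop
  obtain ⟨c, hc⟩ := ((hct.tendsto _).comp hlim).bddAbove_range
  obtain ⟨X', ψ, hψ, hX'⟩ := exists_tendsto_subseq
    (M := fun j => t (φ j) • X (f (φ j))) (fun j => (hX _).smul (htpos _))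
    (fun j => (trace_mono (h2' j)).trans (hc ⟨j, rfl⟩))
  have hM'' := hM'.comp hψ.tendsto_atTop
  have ht0' : Tendsto (fun j => t (φ (ψ j))) atTop (nhds 0) :=
    ht0.comp (hφ.comp hψ).tendsto_atTop
  refine ⟨M', X', posSemidef_of_tendsto hM' fun j => hN _, ?_,
    posSemidef_of_tendsto hX' fun j => (hX _).smul (htpos _), ?_, ?_, ?_⟩
  · intro h0
    have h1 : Tendsto (fun j => (t (φ j) • M (f (φ j))).trace) atTop (nhds M'.trace) :=
      (hct.tendsto _).comp hM'
    have h2 : M'.trace = 1 := tendsto_nhds_unique h1 (by simp [hNtr])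
    rw [h0] at h2; simp at h2
  · have hlim2 : Tendsto (fun j => t (φ (ψ j)) • Q
        + Aᵀ * (t (φ (ψ j)) • M (f (φ (ψ j))) - ρ • (t (φ (ψ j)) • X (f (φ (ψ j))))) * A) atTop
        (nhds ((0 : ℝ) • Q + Aᵀ * (M' - ρ • X') * A)) := by
      have hcA : Continuous fun N : Matrix ι ι ℝ => Aᵀ * N * A := by fun_prop
      exact (ht0'.smul_const Q).add ((hcA.tendsto _).comp (hM''.sub (hX'.const_smul ρ)))
    rw [zero_smul, zero_add] at hlim2
    refine le_of_tendsto_matrix hM'' hlim2 fun j => ?_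
    have := (Matrix.le_iff.1 (h1 (f (φ (ψ j))))).smul (htpos (φ (ψ j)))
    rw [Matrix.le_iff]
    convert this using 1
    simp only [Function.comp, Matrix.mul_smul, Matrix.smul_mul, smul_sub, smul_add, Matrix.mul_sub,
      Matrix.sub_mul, smul_comm ρ]
  · have := le_of_tendsto_matrix hX' (hlim.comp hψ.tendsto_atTop) fun j => h2' (ψ j)
    rwa [zero_add] at this
  · have hcB : Continuous fun N : Matrix ι ι ℝ => Bᵀ * N * B := by fun_prop
    have hlim3 : Tendsto (fun j => Bᵀ * (t (φ (ψ j)) • X (f (φ (ψ j)))) * B + t (φ (ψ j)) • R) atTop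
        (nhds (Bᵀ * X' * B + (0 : ℝ) • R)) :=
      ((hcB.tendsto _).comp hX').add (ht0'.smul_const R)
    rw [zero_smul, add_zero] at hlim3
    refine le_of_tendsto_matrix ((hcB.tendsto _).comp hM'') hlim3 fun j => ?_
    have := (Matrix.le_iff.1 (h3 (f (φ (ψ j))))).smul (htpos (φ (ψ j)))
    rw [Matrix.le_iff]
    convert this using 1
    simp only [Function.comp, Matrix.mul_smul, Matrix.smul_mul, smul_sub, smul_add]

end Limits

/-! ### The linear matrix inequality -/

section Lmi

variable {n m : ℕ} {κ : Type*} [Fintype κ] [DecidableEq κ] {A : Matrix (Fin n) (Fin n) ℝ}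
  {B : Matrix (Fin n) (Fin m) ℝ} {ρ : ℝ} {Y : Matrix (Fin n) (Fin n) ℝ} {Z : Matrix (Fin n) (Fin m) ℝ}

/-- A solution of the linear matrix inequality yields, on every quotient of the state space by an
`A`-invariant subspace, a feedback that contracts a quadratic form on average when the controls are
delivered independently with probability `ρ`. -/
theorem exists_contraction_of_lmi (hρ0 : 0 ≤ ρ) (hρ1 : ρ ≤ 1) (h : (lmiMatrix A B ρ Y Z).PosDef)
    {F : Matrix κ (Fin n) ℝ} {G : Matrix (Fin n) κ ℝ} {A' : Matrix κ κ ℝ} (hFG : F * G = 1)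
    (hFA : F * A = A' * F) :
    ∃ (X : Matrix κ κ ℝ) (L : Matrix (Fin m) κ ℝ), X.PosDef ∧
      (X - ((1 - ρ) • (A'ᵀ * X * A')
        + ρ • ((A' + F * B * L)ᵀ * X * (A' + F * B * L)))).PosDef := by
  have hY : Y.PosDef := by
    have := h.submatrix (e := Sum.inl) Sum.inl_injective
    exact this
  have hFi : Function.Injective Fᵀ.mulVec := by
    intro x y hxy
    have h1 : Gᵀ * Fᵀ = 1 := by rw [← transpose_mul, hFG, transpose_one]
    have := congrArg (Gᵀ.mulVec) hxy
    simpa [h1] using this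
  have hYF : (F * Y * Fᵀ).PosDef := by
    simpa using hY.conjTranspose_mul_mul_same hFi
  obtain ⟨X, hX⟩ : ∃ X, X = (F * Y * Fᵀ)⁻¹ := ⟨_, rfl⟩
  have hXp : X.PosDef := hX ▸ hYF.inv
  have hXu : IsUnit (F * Y * Fᵀ).det := hYF.det_pos.ne'.isUnit
  have hXt : Xᵀ = X := by simpa using hXp.1.eq
  have hYt : Yᵀ = Y := by simpa using hY.1.eq
  -- `X` is the inverse of the image of `Y` in the quotient, and `L` is the feedback `Zᵀ Y⁻¹` there.
  obtain ⟨L, hL⟩ : ∃ L : Matrix (Fin m) κ ℝ, L = Zᵀ * Fᵀ * X := ⟨_, rfl⟩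
  obtain ⟨H, hH⟩ : ∃ H, H = A' + F * B * L := ⟨_, rfl⟩
  obtain ⟨V, hV⟩ : ∃ V, V = Fᵀ * X := ⟨_, rfl⟩
  have hVt : Vᵀ = X * F := by simp [hV, hXt]
  have hXYX : X * F * Y * V = X := by
    rw [hV, ← Matrix.mul_assoc, Matrix.mul_assoc X, Matrix.mul_assoc X, hX,
      Matrix.nonsing_inv_mul _ hXu, Matrix.one_mul]
  have hFYV : F * Y * V = 1 := by
    rw [hV, ← Matrix.mul_assoc, hX, Matrix.mul_nonsing_inv _ hXu]
  have hFAY : F * (A * Y) * V = A' := by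
    rw [← Matrix.mul_assoc, hFA, Matrix.mul_assoc A', Matrix.mul_assoc, hFYV, Matrix.mul_one]
  have hFH : F * (A * Y + B * Zᵀ) * V = H := by
    rw [Matrix.mul_add, Matrix.add_mul, hFAY, hH, hL, hV]
    simp only [Matrix.mul_assoc]
  -- Restricting the form of the block matrix to the range of `T` is a Schur complement.
  set T : Matrix (Fin n ⊕ (Fin n ⊕ Fin n)) κ ℝ :=
    fromRows V (fromRows (-√ρ • (V * H)) (-√(1 - ρ) • (V * A'))) with hT
  have hVi : Function.Injective V.mulVec := by
    intro x y hxy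
    have := congrArg ((F * Y).mulVec) hxy
    simpa [hFYV] using this
  have hTi : Function.Injective T.mulVec := by
    intro x y hxy
    refine hVi (funext fun i => ?_)
    have := congrFun hxy (Sum.inl i)
    simpa [hT, fromRows_mulVec] using this
  refine ⟨X, L, hXp, ?_⟩
  rw [← hH]
  have hmain := h.conjTranspose_mul_mul_same hTi
  rw [conjTranspose_eq_transpose_of_trivial] at hmain
  convert hmain using 1
  have hs1 : √ρ * √ρ = ρ := Real.mul_self_sqrt hρ0
  have hs2 : √(1 - ρ) * √(1 - ρ) = 1 - ρ := Real.mul_self_sqrt (sub_nonneg.2 hρ1)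
  have g1 : Vᵀ * Y * V = X := by rw [hVt]; exact hXYX
  have g2 : Vᵀ * (A * Y + B * Zᵀ) * V = X * H := by
    rw [hVt, Matrix.mul_assoc X, Matrix.mul_assoc X, hFH]
  have g3 : Vᵀ * (A * Y) * V = X * A' := by
    rw [hVt, Matrix.mul_assoc X, Matrix.mul_assoc X, hFAY]
  have g2' : Vᵀ * (Y * Aᵀ + Z * Bᵀ) * V = Hᵀ * X := by
    have := congrArg transpose g2
    simpa [hYt, hXt, Matrix.mul_assoc] using this
  have g3' : Vᵀ * (Y * Aᵀ) * V = A'ᵀ * X := by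
    have := congrArg transpose g3
    simpa [hYt, hXt, Matrix.mul_assoc] using this
  have e : ∀ W : Matrix (Fin n) (Fin n) ℝ, ∀ C D : Matrix κ κ ℝ,
      (V * C)ᵀ * W * (V * D) = Cᵀ * (Vᵀ * W * V) * D := fun W C D => by
    simp only [transpose_mul, Matrix.mul_assoc]
  have e1 : ∀ W : Matrix (Fin n) (Fin n) ℝ, ∀ C : Matrix κ κ ℝ,
      Vᵀ * W * (V * C) = Vᵀ * W * V * C := fun W C => by
    simp only [Matrix.mul_assoc]
  have e2 : ∀ W : Matrix (Fin n) (Fin n) ℝ, ∀ C : Matrix κ κ ℝ,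
      (V * C)ᵀ * W * V = Cᵀ * (Vᵀ * W * V) := fun W C => by
    simp only [transpose_mul, Matrix.mul_assoc]
  rw [hT, lmiMatrix, transpose_fromRows, transpose_fromRows, fromCols_mul_fromBlocks,
    fromCols_mul_fromBlocks, fromCols_mul_fromRows, fromCols_mul_fromRows]
  simp only [fromCols_mul_fromRows, mul_fromCols, fromCols_mul_fromRows, transpose_smul,
    Matrix.smul_mul, Matrix.mul_smul, Matrix.add_mul, Matrix.mul_zero, add_zero, zero_add]
  simp only [e, e1, e2, g1, g2, g3, g2', g3', smul_smul, neg_mul, mul_neg, neg_neg, hs1, hs2]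
  simp only [← Matrix.mul_assoc]
  module

end Lmi

/-! ### One step of the Riccati recursion -/

section Step

variable {ι κ : Type*} [Fintype ι] [Fintype κ]
  {A P P' : Matrix ι ι ℝ} {B : Matrix ι κ ℝ} {R : Matrix κ κ ℝ} {K : Matrix κ ι ℝ}

theorem posDef_gram_add (hP : P.PosSemidef) (hR : R.PosDef) : (Bᵀ * P * B + R).PosDef :=
  hR.posSemidef_add (posSemidef_transpose_mul_mul hP B)

theorem closedLoop_posSemidef (hP : P.PosSemidef) (hR : R.PosSemidef) :
    (closedLoop A P B R K).PosSemidef :=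
  (posSemidef_transpose_mul_mul hP _).add (posSemidef_transpose_mul_mul hR _)

theorem closedLoop_mono (h : P ≤ P') : closedLoop A P B R K ≤ closedLoop A P' B R K :=
  add_le_add_left (transpose_mul_mul_mono h _) _

variable [DecidableEq κ]

theorem closedLoop_optGain_eq (hP : P.PosSemidef) (hR : R.PosDef) :
    closedLoop A P B R (optGain A P B R) = Aᵀ * (P - reduction P B R) * A :=
  closedLoop_optGain (transpose_eq_of_posSemidef hP) (transpose_eq_of_posSemidef hR.posSemidef)
    (posDef_gram_add hP hR).det_pos.ne'.isUnit

theorem closedLoop_optGain_le (hP : P.PosSemidef) (hR : R.PosDef) :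
    closedLoop A P B R (optGain A P B R) ≤ closedLoop A P B R K := by
  rw [closedLoop_optGain_eq hP hR]
  exact reduction_step_le (transpose_eq_of_posSemidef hP)
    (transpose_eq_of_posSemidef hR.posSemidef) (posDef_gram_add hP hR)

theorem closedLoop_optGain_mono (hP : P.PosSemidef) (hR : R.PosDef) (h : P ≤ P') :
    closedLoop A P B R (optGain A P B R) ≤ closedLoop A P' B R (optGain A P' B R) :=
  (closedLoop_optGain_le hP hR).trans (closedLoop_mono h)

theorem reduction_posSemidef (hP : P.PosSemidef) (hR : R.PosDef) :
    (reduction P B R).PosSemidef := by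
  have h := posSemidef_transpose_mul_mul (posDef_gram_add (B := B) hP hR).inv.posSemidef (Bᵀ * P)
  rw [transpose_mul, transpose_transpose, transpose_eq_of_posSemidef hP] at h
  exact h

theorem reduction_le [DecidableEq ι] (hP : P.PosSemidef) (hR : R.PosDef) : reduction P B R ≤ P := by
  have h := closedLoop_posSemidef (A := 1) (B := B) (K := optGain 1 P B R) hP hR.posSemidef
  rw [closedLoop_optGain_eq hP hR] at h
  simpa [Matrix.le_iff] using h

/-- On the range of `B` the reduction exhausts `P`, up to the control weight. With
`S = Bᵀ P B` the defect is `Rᵀ (S + R)⁻¹ R`. -/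
theorem gram_le_reduction_gram_add (hP : P.PosSemidef) (hR : R.PosDef) :
    Bᵀ * P * B ≤ Bᵀ * reduction P B R * B + R := by
  have hT := posDef_gram_add (B := B) hP hR
  have hi := hT.det_pos.ne'.isUnit
  obtain ⟨S, hS⟩ : ∃ S, S = Bᵀ * P * B := ⟨_, rfl⟩
  have h1 : Bᵀ * reduction P B R * B + R - Bᵀ * P * B = Rᵀ * (S + R)⁻¹ * R := by
    rw [← hS] at hi
    have e : Bᵀ * reduction P B R * B = S * (S + R)⁻¹ * S := by
      rw [hS, reduction]; simp only [Matrix.mul_assoc]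
    have e2 : S = S + R - R := by abel
    rw [e, transpose_eq_of_posSemidef hR.posSemidef, ← hS]
    have e3 : S * (S + R)⁻¹ = 1 - R * (S + R)⁻¹ := by
      rw [eq_sub_iff_add_eq, ← Matrix.add_mul, Matrix.mul_nonsing_inv _ hi]
    have e4 : (S + R)⁻¹ * S = 1 - (S + R)⁻¹ * R := by
      rw [eq_sub_iff_add_eq, ← Matrix.mul_add, Matrix.nonsing_inv_mul _ hi]
    rw [e3, Matrix.sub_mul, Matrix.one_mul, Matrix.mul_assoc, e4, Matrix.mul_sub, Matrix.mul_one,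
      ← Matrix.mul_assoc]
    abel
  rw [Matrix.le_iff, h1, hS]
  exact posSemidef_transpose_mul_mul hT.inv.posSemidef R

theorem tendsto_matrix_inv {M : ℕ → Matrix κ κ ℝ} {L : Matrix κ κ ℝ}
    (h : Tendsto M atTop (nhds L)) (hL : L.det ≠ 0) :
    Tendsto (fun k => (M k)⁻¹) atTop (nhds L⁻¹) := by
  simp only [Matrix.inv_def, Ring.inverse_eq_inv']
  have hd : Continuous fun N : Matrix κ κ ℝ => N.det := by fun_prop
  have ha : Continuous fun N : Matrix κ κ ℝ => N.adjugate := by fun_prop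
  exact (((hd.tendsto L).comp h).inv₀ hL).smul ((ha.tendsto L).comp h)

theorem tendsto_optGain {M : ℕ → Matrix ι ι ℝ} (h : Tendsto M atTop (nhds P)) (hP : P.PosSemidef)
    (hR : R.PosDef) :
    Tendsto (fun k => optGain A (M k) B R) atTop (nhds (optGain A P B R)) := by
  have h1 : Continuous fun N : Matrix ι ι ℝ => Bᵀ * N * B + R := by fun_prop
  have h2 : Continuous fun N : Matrix ι ι ℝ => Bᵀ * N * A := by fun_prop
  have h3 : Continuous fun T : Matrix κ κ ℝ × Matrix κ ι ℝ => -(T.1 * T.2) := by fun_prop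
  have h4 : Tendsto (fun k => (Bᵀ * M k * B + R)⁻¹) atTop (nhds (Bᵀ * P * B + R)⁻¹) :=
    tendsto_matrix_inv ((h1.tendsto P).comp h) (posDef_gram_add hP hR).det_pos.ne'
  have h5 : Tendsto (fun k => Bᵀ * M k * A) atTop (nhds (Bᵀ * P * A)) := (h2.tendsto P).comp h
  unfold optGain
  have h6 := (h3.tendsto ((Bᵀ * P * B + R)⁻¹, Bᵀ * P * A)).comp (h4.prodMk_nhds h5)
  exact h6

theorem tendsto_closedLoop_optGain {M : ℕ → Matrix ι ι ℝ} (h : Tendsto M atTop (nhds P))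
    (hP : P.PosSemidef) (hR : R.PosDef) :
    Tendsto (fun k => closedLoop A (M k) B R (optGain A (M k) B R)) atTop
      (nhds (closedLoop A P B R (optGain A P B R))) := by
  have hc : Continuous fun T : Matrix ι ι ℝ × Matrix κ ι ℝ =>
      (A + B * T.2)ᵀ * T.1 * (A + B * T.2) + T.2ᵀ * R * T.2 := by
    fun_prop
  have h1 := (hc.tendsto (P, optGain A P B R)).comp
    (h.prodMk_nhds (tendsto_optGain (A := A) (B := B) h hP hR))
  exact h1

end Step

/-! ### Boundedness of Riccati-type recursions -/

section Bounded

variable {n m : ℕ} {A : Matrix (Fin n) (Fin n) ℝ} {B : Matrix (Fin n) (Fin m) ℝ}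
  {Q : Matrix (Fin n) (Fin n) ℝ} {R : Matrix (Fin m) (Fin m) ℝ}
  {M X : ℕ → Matrix (Fin n) (Fin n) ℝ}

/-- The key boundedness result. Otherwise a blow-up limit, taken modulo its kernel, gives
`1 ≤ (det A')² (1 - ρ) ^ s` on some quotient, where `s` is the rank of `B` there, while the linear
matrix inequality at `ρ₀ < ρ` gives `(det A')² (1 - ρ₀) ^ s < 1`. -/
theorem exists_trace_le_of_feasible {ρ₀ ρ : ℝ} (hρ₀ : ρ₀ ∈ feasibleRates A B) (hρ : ρ₀ < ρ)
    (hρ1 : ρ < 1) (hM : ∀ k, (M k).PosSemidef) (hX : ∀ k, (X k).PosSemidef)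
    (h1 : ∀ k, M k ≤ Q + Aᵀ * (M k - ρ • X k) * A) (h2 : ∀ k, X k ≤ Q + Aᵀ * M k * A)
    (h3 : ∀ k, Bᵀ * M k * B ≤ Bᵀ * X k * B + R) : ∃ c, ∀ k, (M k).trace ≤ c := by
  by_contra! hub
  obtain ⟨h0, -, Y, Z, -, -, hlmi⟩ := hρ₀
  have hρ0' : 0 ≤ ρ := h0.trans hρ.le
  obtain ⟨M', X', hM', hM0, hX', h1', h2', h3'⟩ := exists_homogeneous_of_unbounded hM hX h1 h2 h3 hub
  obtain ⟨κ, _, _, _, F, G, A', Xq, hFG, hFA, hXq, hq1, hq2⟩ :=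
    exists_quotient hρ0' hM' hM0 hX' h1' h2' h3'
  obtain ⟨s, _, _, U, V, C, hU, hUV, hUC⟩ := exists_orthonormal_columns (F * B)
  have hUX : 1 ≤ Uᵀ * Xq * U := by
    have := transpose_mul_mul_mono hq2 C
    have e : Cᵀ * ((F * B)ᵀ * (F * B)) * C = 1 := by
      rw [← hU, hUC]; simp only [transpose_mul, Matrix.mul_assoc]
    have e' : Cᵀ * ((F * B)ᵀ * Xq * (F * B)) * C = Uᵀ * Xq * U := by
      rw [hUC]; simp only [transpose_mul, Matrix.mul_assoc]
    rwa [e, e'] at this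
  have hle := one_le_det_sq_mul hU hXq hUX hρ0' hρ1 hq1
  obtain ⟨W, L, hW, hWL⟩ := exists_contraction_of_lmi h0 (hρ.trans hρ1).le hlmi hFG hFA
  rw [hUV, Matrix.mul_assoc U] at hWL
  have hlt := det_sq_mul_lt_one hU hW h0 (hρ.trans hρ1).le hWL
  have hpow : (1 - ρ) ^ Fintype.card s ≤ (1 - ρ₀) ^ Fintype.card s :=
    pow_le_pow_left₀ (sub_nonneg.2 hρ1.le) (by linarith) _
  nlinarith [mul_le_mul_of_nonneg_left hpow (sq_nonneg A'.det)]

/-- For a controllable pair, `B` does not vanish in any nonzero quotient of the state space by an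
`A`-invariant subspace. -/
theorem eq_zero_of_controllable {κ : Type*} [Fintype κ] [DecidableEq κ] (hAB : Controllable A B)
    {F : Matrix κ (Fin n) ℝ} {A' : Matrix κ κ ℝ} (hFA : F * A = A' * F) (hFB : F * B = 0) :
    F = 0 := by
  have hpow : ∀ j : ℕ, F * (A ^ j * B) = 0 := fun j => by
    have : F * A ^ j = A' ^ j * F := by
      induction j with
      | zero => simp
      | succ j ih => rw [pow_succ, ← Matrix.mul_assoc, ih, Matrix.mul_assoc, hFA, pow_succ,
          Matrix.mul_assoc]
    rw [← Matrix.mul_assoc, this, Matrix.mul_assoc, hFB, Matrix.mul_zero]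
  set C : Matrix (Fin n) (Fin n × Fin m) ℝ := Matrix.of fun (i : Fin n) (kj : Fin n × Fin m) =>
    (A ^ (kj.1 : ℕ) * B) i kj.2 with hC
  have hFC : F * C = 0 := by
    ext i kj
    exact congrFun (congrFun (hpow kj.1) i) kj.2
  have hr : C.rank = n := hAB
  have hli : LinearIndependent ℝ C.row := by
    rw [linearIndependent_iff_card_eq_finrank_span, Set.finrank, ← Matrix.rank_eq_finrank_span_row, hr]
    simp
  have hinj := Matrix.vecMul_injective_iff.2 hli
  ext i j
  have h0 : F i ᵥ* C = 0 ᵥ* C := by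
    rw [zero_vecMul]; exact congrFun hFC i
  exact congrFun (hinj h0) j

/-- The counterpart of `exists_trace_le_of_feasible` at the rate one. Here the blow-up limit has to
annihilate `B`, against controllability. -/
theorem exists_trace_le_of_controllable (hAB : Controllable A B) (hM : ∀ k, (M k).PosSemidef)
    (hX : ∀ k, (X k).PosSemidef)
    (h1 : ∀ k, M k ≤ Q + Aᵀ * (M k - X k) * A) (h2 : ∀ k, X k ≤ Q + Aᵀ * M k * A)
    (h3 : ∀ k, Bᵀ * M k * B ≤ Bᵀ * X k * B + R) : ∃ c, ∀ k, (M k).trace ≤ c := by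
  by_contra! hub
  obtain ⟨M', X', hM', hM0, hX', h1', h2', h3'⟩ :=
    exists_homogeneous_of_unbounded (ρ := 1) hM hX (by simpa using h1) h2 h3 hub
  obtain ⟨κ, _, _, _, F, G, A', Xq, hFG, hFA, hXq, hq1, hq2⟩ :=
    exists_quotient zero_le_one hM' hM0 hX' h1' h2' h3'
  rw [one_smul] at hq1
  have hpd : (A'ᵀ * (1 - Xq) * A').PosDef := by
    have := (PosDef.one (n := κ) (R := ℝ)).add_posSemidef (Matrix.le_iff.1 hq1)
    rwa [add_sub_cancel] at this
  have hdet : IsUnit A'.det := by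
    have := hpd.det_pos.ne'
    rw [det_mul, mul_ne_zero_iff] at this
    exact this.2.isUnit
  have hpd' : (1 - Xq).PosDef := by
    have h := hpd.conjTranspose_mul_mul_same (B := A'⁻¹)
      (Matrix.mulVec_injective_iff_isUnit.2 (by simpa [Matrix.isUnit_iff_isUnit_det] using hdet))
    have e : A'⁻¹ᵀ * A'ᵀ = 1 := by
      rw [← transpose_mul, Matrix.mul_nonsing_inv _ hdet, transpose_one]
    rw [conjTranspose_eq_transpose_of_trivial, ← Matrix.mul_assoc, ← Matrix.mul_assoc, e,
      Matrix.one_mul, Matrix.mul_assoc, Matrix.mul_nonsing_inv _ hdet, Matrix.mul_one] at h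
    exact h
  have hFB : F * B = 0 := by
    ext i j
    set x := (F * B) *ᵥ Pi.single j 1 with hx
    have h := dotProduct_mulVec_mono hq2 (Pi.single j 1)
    have e : (F * B)ᵀ * (F * B) = (F * B)ᵀ * (1 : Matrix κ κ ℝ) * (F * B) := by rw [Matrix.mul_one]
    rw [e, dotProduct_transpose_mul_mul, dotProduct_transpose_mul_mul, ← hx] at h
    by_contra hne
    have hx0 : x ≠ 0 := fun h0 => hne (by simpa [hx] using congrFun h0 i)
    have := hpd'.dotProduct_mulVec_pos hx0
    rw [sub_mulVec, star_trivial, dotProduct_sub] at this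
    linarith
  have hF0 := eq_zero_of_controllable hAB hFA hFB
  rw [hF0, Matrix.zero_mul] at hFG
  exact zero_ne_one hFG

end Bounded

/-! ### Feasibility of the rate one -/

section Feasible

variable {n m : ℕ} {A : Matrix (Fin n) (Fin n) ℝ} {B : Matrix (Fin n) (Fin m) ℝ}

/-- For a controllable pair, the Riccati iteration converges and its limit `X` satisfies
`(A + B K)ᵀ X (A + B K) < X` for a feedback `K`. -/
theorem exists_stabilizing_of_controllable (hAB : Controllable A B) :
    ∃ (X : Matrix (Fin n) (Fin n) ℝ) (K : Matrix (Fin m) (Fin n) ℝ), X.PosDef ∧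
      (X - (A + B * K)ᵀ * X * (A + B * K)).PosDef := by
  set f : Matrix (Fin n) (Fin n) ℝ → Matrix (Fin n) (Fin n) ℝ := fun P =>
    1 + closedLoop A P B 1 (optGain A P B 1) with hf
  have hR : (1 : Matrix (Fin m) (Fin m) ℝ).PosDef := PosDef.one
  have hfP : ∀ P, P.PosSemidef → (f P).PosSemidef := fun P hP =>
    PosSemidef.one.add (closedLoop_posSemidef hP hR.posSemidef)
  have hfmono : ∀ P P', P.PosSemidef → P ≤ P' → f P ≤ f P' := fun P P' hP h =>
    add_le_add_right (closedLoop_optGain_mono hP hR h) _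
  set M : ℕ → Matrix (Fin n) (Fin n) ℝ := fun k => f^[k] 0 with hMdef
  have hMs : ∀ k, M (k + 1) = f (M k) := fun k => Function.iterate_succ_apply' f k 0
  have hM : ∀ k, (M k).PosSemidef := fun k => by
    induction k with
    | zero => exact PosSemidef.zero
    | succ k ih => rw [hMs]; exact hfP _ ih
  have hstep : ∀ k, M k ≤ M (k + 1) := fun k => by
    induction k with
    | zero => exact Matrix.nonneg_iff_posSemidef.2 (hM 1)
    | succ k ih => rw [hMs k, hMs (k + 1)]; exact hfmono _ _ (hM k) ih
  have hMk : ∀ k, M (k + 1) = 1 + Aᵀ * (M k - reduction (M k) B 1) * A := fun k => by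
    rw [hMs, hf, ← closedLoop_optGain_eq (hM k) hR]
  have hred : ∀ k, (reduction (M k) B 1).PosSemidef := fun k => reduction_posSemidef (hM k) hR
  have hMle : ∀ k, M (k + 1) ≤ 1 + Aᵀ * M k * A := fun k => by
    rw [hMk]
    refine add_le_add_right (transpose_mul_mul_mono ?_ A) _
    exact sub_le_self _ (Matrix.nonneg_iff_posSemidef.2 (hred k))
  obtain ⟨c, hc⟩ := exists_trace_le_of_controllable (Q := 1) (R := 1) hAB hM hred
    (fun k => (hstep k).trans (hMk k).le)
    (fun k => ((reduction_le (hM k) hR).trans (hstep k)).trans (hMle k))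
    (fun k => gram_le_reduction_gram_add (hM k) hR)
  obtain ⟨X, hX, hlim⟩ := exists_tendsto_of_monotone hM (monotone_nat_of_le_succ hstep) hc
  have hfix : X = 1 + closedLoop A X B 1 (optGain A X B 1) := by
    refine tendsto_nhds_unique (hlim.comp (tendsto_add_atTop_nat 1)) ?_
    refine Tendsto.congr (fun k => (hMs k).symm) ?_
    exact tendsto_const_nhds.add (tendsto_closedLoop_optGain hlim hX hR)
  set K := optGain A X B 1
  refine ⟨X, K, ?_, ?_⟩
  · rw [hfix]
    exact PosDef.one.add_posSemidef (closedLoop_posSemidef hX hR.posSemidef)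
  · have e : X - (A + B * K)ᵀ * X * (A + B * K) = 1 + Kᵀ * (1 : Matrix (Fin m) (Fin m) ℝ) * K := by
      nth_rewrite 1 [hfix]
      rw [closedLoop]
      abel
    rw [e]
    exact PosDef.one.add_posSemidef (posSemidef_transpose_mul_mul hR.posSemidef K)

theorem le_trace_smul_one {ι : Type*} [Fintype ι] [DecidableEq ι] {M : Matrix ι ι ℝ}
    (hM : M.PosSemidef) : M ≤ M.trace • (1 : Matrix ι ι ℝ) := by
  refine Matrix.le_iff.2 (posSemidef_of_forall ?_ fun x => ?_)
  · simp [transpose_eq_of_posSemidef hM]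
  · obtain ⟨C, hC⟩ := exists_transpose_mul_self hM
    have h1 : x ⬝ᵥ M *ᵥ x = ∑ i, (C i ⬝ᵥ x) ^ 2 := by
      rw [hC, ← mulVec_mulVec, dotProduct_mulVec, vecMul_transpose, dotProduct]
      exact Finset.sum_congr rfl fun i _ => (sq _).symm
    have h2 : M.trace = ∑ i, C i ⬝ᵥ C i := by
      rw [hC, trace_mul_comm]; rfl
    rw [sub_mulVec, smul_mulVec, one_mulVec, dotProduct_sub, dotProduct_smul, h1, h2, smul_eq_mul,
      Finset.sum_mul, ← Finset.sum_sub_distrib]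
    refine Finset.sum_nonneg fun i _ => sub_nonneg.2 ?_
    have := Finset.sum_mul_sq_le_sq_mul_sq Finset.univ (C i) x
    simpa [dotProduct, sq] using this

/-- At the rate one the linear matrix inequality is Lyapunov's inequality for `W = Y⁻¹` and a
feedback `K`. -/
theorem lmiMatrix_one_posDef {Y W : Matrix (Fin n) (Fin n) ℝ} {K : Matrix (Fin m) (Fin n) ℝ}
    (hY : Y.PosDef) (hYW : Y * W = 1) (h : (W - (A + B * K)ᵀ * W * (A + B * K)).PosDef) :
    (lmiMatrix A B 1 Y (K * Y)ᵀ).PosDef := by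
  have hYt := transpose_eq_of_posSemidef hY.posSemidef
  have hWY : W * Y = 1 := mul_eq_one_comm.1 hYW
  obtain ⟨H, hH⟩ : ∃ H, H = A + B * K := ⟨_, rfl⟩
  have e1 : A * Y + B * (K * Y)ᵀᵀ = H * Y := by
    rw [transpose_transpose, hH, Matrix.add_mul, Matrix.mul_assoc B]
  have e2 : Y * Aᵀ + (K * Y)ᵀ * Bᵀ = Y * Hᵀ := by
    rw [hH, transpose_add, transpose_mul, transpose_mul, hYt, Matrix.mul_add, Matrix.mul_assoc]
  rw [← hH] at h
  rw [lmiMatrix, e1, e2, sub_self, Real.sqrt_one, Real.sqrt_zero, one_smul, one_smul, zero_smul,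
    zero_smul]
  refine PosDef.of_dotProduct_mulVec_pos ?_ fun x hx => ?_
  · rw [IsHermitian, fromBlocks_conjTranspose, fromBlocks_conjTranspose]
    simp only [conjTranspose_eq_transpose_of_trivial, transpose_fromCols, transpose_fromRows,
      transpose_mul, transpose_transpose, hYt, transpose_zero]
  obtain ⟨a, b, d, rfl⟩ : ∃ a b d, x = Sum.elim a (Sum.elim b d) :=
    ⟨x ∘ Sum.inl, x ∘ Sum.inr ∘ Sum.inl, x ∘ Sum.inr ∘ Sum.inr, by ext (i | i | i) <;> rfl⟩
  rw [star_trivial]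
  -- Complete the square in `b`; the remaining form is that of `h` at `Y a`.
  have hsq : Sum.elim a (Sum.elim b d) ⬝ᵥ fromBlocks Y (fromCols (Y * Hᵀ) 0) (fromRows (H * Y) 0)
      (fromBlocks Y 0 0 Y) *ᵥ Sum.elim a (Sum.elim b d)
      = (Y *ᵥ a) ⬝ᵥ (W - Hᵀ * W * H) *ᵥ (Y *ᵥ a)
        + (b + (W * H) *ᵥ (Y *ᵥ a)) ⬝ᵥ Y *ᵥ (b + (W * H) *ᵥ (Y *ᵥ a)) + d ⬝ᵥ Y *ᵥ d := by
    have ha : W *ᵥ (Y *ᵥ a) = a := by rw [mulVec_mulVec, hWY, one_mulVec]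
    obtain ⟨y, hy⟩ : ∃ y, y = Y *ᵥ a := ⟨_, rfl⟩
    rw [← hy] at ha ⊢
    have t1 : Y *ᵥ ((W * H) *ᵥ y) = H *ᵥ y := by
      rw [mulVec_mulVec, ← Matrix.mul_assoc, hYW, Matrix.one_mul]
    have t2 : ((W * H) *ᵥ y) ⬝ᵥ Y *ᵥ b = (H *ᵥ y) ⬝ᵥ b := by
      rw [dotProduct_mulVec, ← mulVec_transpose, hYt, t1]
    have t3 : ((W * H) *ᵥ y) ⬝ᵥ (H *ᵥ y) = y ⬝ᵥ (Hᵀ * W * H) *ᵥ y := by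
      rw [dotProduct_transpose_mul_mul, ← mulVec_mulVec, dotProduct_comm]
    have t4 : a ⬝ᵥ (Y * Hᵀ) *ᵥ b = (H *ᵥ y) ⬝ᵥ b := by
      rw [dotProduct_mulVec, ← mulVec_transpose, transpose_mul, transpose_transpose, hYt,
        ← mulVec_mulVec, hy]
    have t5 : (H * Y) *ᵥ a = H *ᵥ y := by rw [hy, mulVec_mulVec]
    have t6 : a ⬝ᵥ Y *ᵥ a = y ⬝ᵥ W *ᵥ y := by rw [ha, ← hy, dotProduct_comm]
    simp only [fromBlocks_mulVec, Sum.elim_comp_inl, Sum.elim_comp_inr, fromCols_mulVec,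
      fromRows_mulVec, zero_mulVec, add_zero, zero_add, sumElim_dotProduct_sumElim,
      dotProduct_add, add_dotProduct, mulVec_add, sub_mulVec, dotProduct_sub, t1, t2, t3, t4, t5,
      t6, Sum.elim_add_add,
      dotProduct_zero]
    rw [dotProduct_comm b (H *ᵥ y)]
    ring
  rw [hsq]
  have p1 := dotProduct_mulVec_nonneg h.posSemidef (Y *ᵥ a)
  have p2 := dotProduct_mulVec_nonneg hY.posSemidef (b + (W * H) *ᵥ (Y *ᵥ a))
  have p3 := dotProduct_mulVec_nonneg hY.posSemidef d
  by_cases hya : Y *ᵥ a = 0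
  · have ha : a = 0 := by
      rw [← one_mulVec a, ← hWY, ← mulVec_mulVec, hya, mulVec_zero]
    rw [hya] at p1 p2 ⊢
    simp only [mulVec_zero, add_zero, dotProduct_zero, zero_add] at p2 ⊢
    by_cases hb : b = 0
    · have hd : d ≠ 0 := by
        rintro rfl
        exact hx (by rw [ha, hb]; ext (i | i | i) <;> rfl)
      have := hY.dotProduct_mulVec_pos hd
      rw [star_trivial] at this
      linarith
    · have := hY.dotProduct_mulVec_pos hb
      rw [star_trivial] at this
      linarith
  · have := h.dotProduct_mulVec_pos hya
    rw [star_trivial] at this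
    linarith

theorem one_mem_feasibleRates (hAB : Controllable A B) : (1 : ℝ) ∈ feasibleRates A B := by
  obtain ⟨X, K, hX, hXK⟩ := exists_stabilizing_of_controllable hAB
  have hXu : IsUnit X.det := hX.det_pos.ne'.isUnit
  have hi := hX.inv
  have htr : 0 ≤ X⁻¹.trace := hi.posSemidef.trace_nonneg
  -- The scaling by `c` ensures `Y = c X⁻¹ ≤ 1`.
  set c : ℝ := (1 + X⁻¹.trace)⁻¹ with hc
  have hc0 : 0 < c := by positivity
  refine ⟨zero_le_one, le_rfl, c • X⁻¹, (K * (c • X⁻¹))ᵀ, hi.posSemidef.smul hc0.le, ?_, ?_⟩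
  · rw [← Matrix.le_iff]
    refine (smul_le_smul_of_nonneg_left (le_trace_smul_one hi.posSemidef) hc0.le).trans ?_
    rw [smul_smul, Matrix.le_iff]
    have e : (1 : Matrix (Fin n) (Fin n) ℝ) - (c * X⁻¹.trace) • 1 = (1 - c * X⁻¹.trace) • 1 := by
      module
    rw [e]
    refine PosSemidef.one.smul ?_
    have : c * (1 + X⁻¹.trace) = 1 := inv_mul_cancel₀ (by positivity)
    nlinarith
  · refine lmiMatrix_one_posDef (W := c⁻¹ • X) (hi.smul hc0) ?_ ?_
    · rw [Matrix.smul_mul, Matrix.mul_smul, smul_smul, mul_inv_cancel₀ hc0.ne', one_smul,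
        Matrix.nonsing_inv_mul _ hXu]
    · have := hXK.smul (inv_pos.2 hc0)
      rw [smul_sub] at this
      simpa only [Matrix.mul_smul, Matrix.smul_mul] using this

end Feasible

/-! ### The coupled recursion of the two jamming modes -/

section Mean

variable {ι : Type*} {p : ℝ}

/-- The average of the cost matrices of the two modes: the next step is jammed (mode `true`)
with probability `p`. -/
def modeMean (p : ℝ) (P : Bool → Matrix ι ι ℝ) : Matrix ι ι ℝ := p • P true + (1 - p) • P false

theorem modeMean_posSemidef {P : Bool → Matrix ι ι ℝ} (hp : 0 ≤ p) (hp1 : p ≤ 1) (hP : ∀ b, (P b).PosSemidef) :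
    (modeMean p P).PosSemidef :=
  ((hP true).smul hp).add ((hP false).smul (sub_nonneg.2 hp1))

theorem tendsto_modeMean {P : ℕ → Bool → Matrix ι ι ℝ} {L : Bool → Matrix ι ι ℝ}
    (h : ∀ b, Tendsto (fun k => P k b) atTop (nhds (L b))) :
    Tendsto (fun k => modeMean p (P k)) atTop (nhds (modeMean p L)) :=
  ((h true).const_smul p).add ((h false).const_smul (1 - p))

end Mean

section Riccati

variable {ι κ : Type*} [Fintype ι] [Fintype κ] [DecidableEq κ]
  (A Q : Matrix ι ι ℝ) (B : Matrix ι κ ℝ) (R : Matrix κ κ ℝ) (p : ℝ)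

/-- One step of dynamic programming for the cost matrices of the jammed mode `true` and of the
free mode `false`. In the free mode the control is delivered with probability `p`, and then
the next mode is `true`. -/
noncomputable def riccati (P : Bool → Matrix ι ι ℝ) : Bool → Matrix ι ι ℝ
  | true => Q + Aᵀ * modeMean p P * A
  | false => Q + ((1 - p) • (Aᵀ * P false * A)
      + p • closedLoop A (P true) B R (optGain A (P true) B R))

variable {A Q B R p} {P P' : Bool → Matrix ι ι ℝ}

theorem modeMean_mono (hp : 0 ≤ p) (hp1 : p ≤ 1) (h : ∀ b, P b ≤ P' b) :
    modeMean p P ≤ modeMean p P' :=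
  add_le_add (smul_le_smul_of_nonneg_left (h _) hp)
    (smul_le_smul_of_nonneg_left (h _) (sub_nonneg.2 hp1))

theorem riccati_posSemidef (hQ : Q.PosSemidef) (hR : R.PosDef) (hp : 0 ≤ p) (hp1 : p ≤ 1)
    (hP : ∀ b, (P b).PosSemidef) (b : Bool) : (riccati A Q B R p P b).PosSemidef := by
  cases b
  · exact hQ.add (((posSemidef_transpose_mul_mul (hP _) A).smul (sub_nonneg.2 hp1)).add
      ((closedLoop_posSemidef (hP _) hR.posSemidef).smul hp))
  · exact hQ.add (posSemidef_transpose_mul_mul (modeMean_posSemidef hp hp1 hP) A)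

theorem riccati_mono (hR : R.PosDef) (hp : 0 ≤ p) (hp1 : p ≤ 1)
    (hP : ∀ b, (P b).PosSemidef) (h : ∀ b, P b ≤ P' b) (b : Bool) :
    riccati A Q B R p P b ≤ riccati A Q B R p P' b := by
  cases b
  · exact add_le_add_right (add_le_add
      (smul_le_smul_of_nonneg_left (transpose_mul_mul_mono (h _) A) (sub_nonneg.2 hp1))
      (smul_le_smul_of_nonneg_left (closedLoop_optGain_mono (hP _) hR (h _)) hp)) _
  · exact add_le_add_right (transpose_mul_mul_mono (modeMean_mono hp hp1 h) A) _

theorem riccati_false_eq (hR : R.PosDef) (hP : (P true).PosSemidef) :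
    riccati A Q B R p P false
      = Q + Aᵀ * (modeMean p P - p • reduction (P true) B R) * A := by
  rw [riccati, closedLoop_optGain_eq hP hR, modeMean]
  simp only [Matrix.mul_add, Matrix.mul_sub, Matrix.add_mul, Matrix.sub_mul, Matrix.mul_smul,
    Matrix.smul_mul, smul_sub]
  abel

theorem riccati_false_le_true (hR : R.PosDef) (hp : 0 ≤ p) (hP : (P true).PosSemidef) :
    riccati A Q B R p P false ≤ riccati A Q B R p P true := by
  rw [riccati_false_eq hR hP, riccati]
  refine add_le_add_right (transpose_mul_mul_mono ?_ A) _
  exact sub_le_self _ (Matrix.nonneg_iff_posSemidef.2 ((reduction_posSemidef hP hR).smul hp))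

/-- The mean of the two modes follows a recursion of Riccati type with the rate `p (1 - p)`, which is why
this product has to exceed a feasible rate. -/
theorem modeMean_riccati (hR : R.PosDef) (hP : (P true).PosSemidef) :
    modeMean p (riccati A Q B R p P)
      = Q + Aᵀ * (modeMean p P - (p * (1 - p)) • reduction (P true) B R) * A := by
  rw [modeMean, riccati_false_eq hR hP, riccati]
  simp only [Matrix.mul_sub, Matrix.sub_mul, Matrix.mul_smul, Matrix.smul_mul]
  module

theorem tendsto_riccati (hR : R.PosDef) {P : ℕ → Bool → Matrix ι ι ℝ} {L : Bool → Matrix ι ι ℝ}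
    (hL : ∀ b, (L b).PosSemidef) (h : ∀ b, Tendsto (fun k => P k b) atTop (nhds (L b)))
    (b : Bool) :
    Tendsto (fun k => riccati A Q B R p (P k) b) atTop (nhds (riccati A Q B R p L b)) := by
  have hc : Continuous fun N : Matrix ι ι ℝ => Aᵀ * N * A := by fun_prop
  cases b
  · exact tendsto_const_nhds.add ((((hc.tendsto _).comp (h false)).const_smul (1 - p)).add
      ((tendsto_closedLoop_optGain (h true) (hL true) hR).const_smul p))
  · exact tendsto_const_nhds.add ((hc.tendsto _).comp (tendsto_modeMean h))

end Riccati

section FixedPoint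

variable {n m : ℕ} {A : Matrix (Fin n) (Fin n) ℝ} {B : Matrix (Fin n) (Fin m) ℝ}
  {Q : Matrix (Fin n) (Fin n) ℝ} {R : Matrix (Fin m) (Fin m) ℝ}

/-- If some feasible rate lies below `p (1 - p)`, the iterates of the coupled recursion started at
zero converge to a fixed point. -/
theorem exists_riccati_fixedPoint (hQ : Q.PosSemidef) (hR : R.PosDef) {p ρ₀ : ℝ} (hp : 0 < p)
    (hp1 : p < 1) (hρ₀ : ρ₀ ∈ feasibleRates A B) (hlt : ρ₀ < p * (1 - p)) :
    ∃ P : Bool → Matrix (Fin n) (Fin n) ℝ, (∀ b, (P b).PosSemidef) ∧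
      riccati A Q B R p P = P ∧
      ∀ b, Tendsto (fun k => (riccati A Q B R p)^[k] 0 b) atTop (nhds (P b)) := by
  set P : ℕ → Bool → Matrix (Fin n) (Fin n) ℝ := fun k => (riccati A Q B R p)^[k] 0 with hPdef
  have hPs : ∀ k, P (k + 1) = riccati A Q B R p (P k) := fun k =>
    Function.iterate_succ_apply' _ k 0
  have hP : ∀ k b, (P k b).PosSemidef := fun k => by
    induction k with
    | zero => exact fun b => PosSemidef.zero
    | succ k ih => rw [hPs]; exact riccati_posSemidef hQ hR hp.le hp1.le ih
  have hstep : ∀ k b, P k b ≤ P (k + 1) b := fun k => by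
    induction k with
    | zero => exact fun b => Matrix.nonneg_iff_posSemidef.2 (hP 1 b)
    | succ k ih => rw [hPs k, hPs (k + 1)]; exact riccati_mono hR hp.le hp1.le (hP k) ih
  have h01 : ∀ k, P k false ≤ P k true := fun k => by
    cases k with
    | zero => exact le_rfl
    | succ k => rw [hPs]; exact riccati_false_le_true hR hp.le (hP k true)
  have hM := fun k => modeMean_posSemidef hp.le hp1.le (hP k)
  have hMle : ∀ k, modeMean p (P k) ≤ P k true := fun k => by
    refine (add_le_add_right
      (smul_le_smul_of_nonneg_left (h01 k) (sub_nonneg.2 hp1.le)) _).trans (le_of_eq ?_)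
    module
  obtain ⟨c, hc⟩ := exists_trace_le_of_feasible (Q := Q) (R := R)
    (M := fun k => modeMean p (P k)) (X := fun k => reduction (P k true) B R) hρ₀ hlt
    (by nlinarith) hM (fun k => reduction_posSemidef (hP k true) hR)
    (fun k => by
      rw [← modeMean_riccati hR (hP k true), ← hPs]
      exact modeMean_mono hp.le hp1.le (hstep k))
    (fun k => by
      refine (reduction_le (hP k true) hR).trans ((hstep k true).trans (le_of_eq ?_))
      rw [hPs, riccati])
    (fun k => (transpose_mul_mul_mono (hMle k) B).trans
      (gram_le_reduction_gram_add (hP k true) hR))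
  have htr : ∀ k b, 0 ≤ (P k b).trace := fun k b => (hP k b).trace_nonneg
  have hsum : ∀ k, p * (P k true).trace + (1 - p) * (P k false).trace ≤ c := fun k => by
    have := hc k
    simpa [modeMean, trace_add, trace_smul] using this
  have hbound : ∀ b k, (P k b).trace ≤ c / (p * (1 - p)) := fun b k => by
    have h1 := mul_nonneg hp.le (htr k true)
    have h2 := mul_nonneg (sub_nonneg.2 hp1.le) (htr k false)
    have h3 := hsum k
    rw [le_div_iff₀ (mul_pos hp (sub_pos.2 hp1))]
    cases b <;> nlinarith
  choose L hL hlim using fun b => exists_tendsto_of_monotone (M := fun k => P k b)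
    (fun k => hP k b) (monotone_nat_of_le_succ fun k => hstep k b) (hbound b)
  refine ⟨L, hL, funext fun b => ?_, hlim⟩
  refine tendsto_nhds_unique (tendsto_riccati hR hL hlim b) ?_
  exact ((hlim b).comp (tendsto_add_atTop_nat 1)).congr fun k => congrFun (hPs k) b

end FixedPoint

/-! ### Resampling one coordinate -/

section Resample

/-- Replacing one coordinate of an i.i.d. sequence by an independent copy does not change its law. -/
theorem lintegral_infinitePi_update {E : Type*} [MeasurableSpace E] (μ : Measure E)
    [IsProbabilityMeasure μ] (t : ℕ) {F : (ℕ → E) → ℝ≥0∞} (hF : Measurable F) :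
    ∫⁻ x, F x ∂(Measure.infinitePi fun _ : ℕ => μ)
      = ∫⁻ x, ∫⁻ a, F (Function.update x t a) ∂μ ∂(Measure.infinitePi fun _ : ℕ => μ) := by
  set ν := Measure.infinitePi fun _ : ℕ => μ with hν
  have hup : Measurable fun z : (ℕ → E) × E => Function.update z.1 t z.2 := by
    refine measurable_pi_iff.2 fun i => ?_
    by_cases h : i = t
    · subst h; simpa using measurable_snd
    · simp only [Function.update_of_ne h]
      exact (measurable_pi_apply i).comp measurable_fst
  have hmap : (ν.prod μ).map (fun z : (ℕ → E) × E => Function.update z.1 t z.2) = ν := by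
    refine Measure.eq_infinitePi _ fun s A hA => ?_
    rw [Measure.map_apply hup (MeasurableSet.pi s.countable_toSet fun i _ => hA i)]
    have hpre : (fun z : (ℕ → E) × E => Function.update z.1 t z.2) ⁻¹' Set.pi s A
        = Set.pi (s.erase t) A ×ˢ (if t ∈ s then A t else Set.univ) := by
      ext ⟨x, a⟩
      simp only [Set.mem_preimage, Set.mem_pi, Finset.mem_coe, Finset.mem_erase, Set.mem_prod]
      constructor
      · refine fun h => ⟨fun i hi => ?_, ?_⟩
        · simpa [Function.update_of_ne hi.1] using h i hi.2
        · split_ifs with ht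
          · simpa using h t ht
          · trivial
      · rintro ⟨h1, h2⟩ i hi
        by_cases hit : i = t
        · subst hit; simpa [hi] using h2
        · simpa [Function.update_of_ne hit] using h1 i ⟨hit, hi⟩
    rw [hpre, Measure.prod_prod, hν, Measure.infinitePi_pi _ fun i _ => hA i]
    by_cases ht : t ∈ s
    · rw [if_pos ht, Finset.prod_erase_mul _ _ ht]
    · rw [if_neg ht, measure_univ, mul_one, Finset.erase_eq_of_notMem ht]
  conv_lhs => rw [← hmap]
  rw [lintegral_map hF hup]
  exact lintegral_prod _ (hF.comp hup).aemeasurable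

theorem lintegral_bernoulli (p : unitInterval) (f : Bool → ℝ≥0∞) :
    ∫⁻ a, f a ∂(bernoulliMeasure true false p)
      = ENNReal.ofReal p * f true + ENNReal.ofReal (1 - p) * f false := by
  rw [bernoulliMeasure_def, lintegral_add_measure, lintegral_smul_measure, lintegral_smul_measure,
    lintegral_dirac, lintegral_dirac, ENNReal.smul_def, ENNReal.smul_def]
  congr 2
  · exact (ENNReal.ofReal_eq_coe_nnreal p.2.1).symm
  · exact (ENNReal.ofReal_eq_coe_nnreal (unitInterval.symm p).2.1).symm

variable {n : ℕ} {S : Matrix (Fin n) (Fin n) ℝ}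

instance : IsProbabilityMeasure (noiseLaw S) :=
  Measure.isProbabilityMeasure_map (by fun_prop)

instance (μ₀ : Measure (Fin n → ℝ)) [IsProbabilityMeasure μ₀] (p : unitInterval) :
    IsProbabilityMeasure (sampleLaw μ₀ p S) := by
  unfold sampleLaw; infer_instance

/-- The sample point in which the decision and the noise of time `t` are replaced. -/
def resample (ω : Sample n) (t : ℕ) (a : Bool) (v : Fin n → ℝ) : Sample n :=
  (ω.1, Function.update ω.2.1 t a, Function.update ω.2.2 t v)

theorem measurable_resample (t : ℕ) (a : Bool) :
    Measurable fun z : Sample n × (Fin n → ℝ) => resample z.1 t a z.2 := by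
  have h1 : Measurable fun z : Sample n × (Fin n → ℝ) => Function.update z.1.2.1 t a := by
    refine measurable_pi_iff.2 fun i => ?_
    by_cases h : i = t
    · subst h; simp
    · simp only [Function.update_of_ne h]; fun_prop
  have h2 : Measurable fun z : Sample n × (Fin n → ℝ) => Function.update z.1.2.2 t z.2 := by
    refine measurable_pi_iff.2 fun i => ?_
    by_cases h : i = t
    · subst h; simpa using measurable_snd
    · simp only [Function.update_of_ne h]; fun_prop
  exact (measurable_fst.comp measurable_fst).prodMk (h1.prodMk h2)

/-- Integrating out the decision and the noise of time `t`. -/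
theorem lintegral_sampleLaw (μ₀ : Measure (Fin n → ℝ)) [IsProbabilityMeasure μ₀]
    (p : unitInterval) (t : ℕ) {F : Sample n → ℝ≥0∞} (hF : Measurable F) :
    ∫⁻ ω, F ω ∂(sampleLaw μ₀ p S)
      = ∫⁻ ω, (ENNReal.ofReal p * ∫⁻ v, F (resample ω t true v) ∂(noiseLaw S)
          + ENNReal.ofReal (1 - p) * ∫⁻ v, F (resample ω t false v) ∂(noiseLaw S))
          ∂(sampleLaw μ₀ p S) := by
  have hm : ∀ a, Measurable fun ω : Sample n =>
      ∫⁻ v, F (resample ω t a v) ∂(noiseLaw S) := fun a =>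
    (hF.comp (measurable_resample t a)).lintegral_prod_right'
  rw [sampleLaw, lintegral_prod _ hF.aemeasurable]
  refine Eq.trans ?_
    (lintegral_prod _ (((hm true).const_mul _).add ((hm false).const_mul _)).aemeasurable).symm
  refine lintegral_congr fun x => ?_
  have hFx : Measurable fun z => F (x, z) := hF.comp measurable_prodMk_left
  have hmx : ∀ a, Measurable fun z : (ℕ → Bool) × (ℕ → (Fin n → ℝ)) =>
      ∫⁻ v, F (resample (x, z) t a v) ∂(noiseLaw S) := fun a => (hm a).comp measurable_prodMk_left
  rw [lintegral_prod _ hFx.aemeasurable, lintegral_infinitePi_update _ t hFx.lintegral_prod_right']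
  refine Eq.trans ?_
    (lintegral_prod _ (((hmx true).const_mul _).add ((hmx false).const_mul _)).aemeasurable).symm
  refine lintegral_congr fun α => ?_
  rw [lintegral_bernoulli]
  have hmα : ∀ a, Measurable fun w : ℕ → (Fin n → ℝ) =>
      ∫⁻ v, F (resample (x, α, w) t a v) ∂(noiseLaw S) := fun a =>
    (hmx a).comp measurable_prodMk_left
  refine Eq.trans ?_ (lintegral_add_left ((hmα true).const_mul _) _).symm
  rw [lintegral_const_mul _ (hmα true), lintegral_const_mul _ (hmα false)]
  have hup : ∀ a, ∫⁻ w, F (x, Function.update α t a, w)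
        ∂(Measure.infinitePi fun _ : ℕ => noiseLaw S)
      = ∫⁻ w, ∫⁻ v, F (resample (x, α, w) t a v) ∂(noiseLaw S)
        ∂(Measure.infinitePi fun _ : ℕ => noiseLaw S) := fun a =>
    lintegral_infinitePi_update _ t (hFx.comp measurable_prodMk_left)
  rw [hup, hup]

end Resample

/-! ### Quadratic forms of the noise -/

section Noise

variable {n : ℕ} {S P : Matrix (Fin n) (Fin n) ℝ}

theorem lintegral_noise_quadratic (hS : S.PosSemidef) (hP : P.PosSemidef) {c : ℝ} (hc : 0 ≤ c)
    (y : Fin n → ℝ) :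
    ∫⁻ v, ENNReal.ofReal (c + (y + v) ⬝ᵥ P *ᵥ (y + v)) ∂(noiseLaw S)
      = ENNReal.ofReal (c + y ⬝ᵥ P *ᵥ y + (S * P).trace) := by
  set g := multivariateGaussian (0 : EuclideanSpace ℝ (Fin n)) S with hg
  have hmap : AEMeasurable (WithLp.ofLp : EuclideanSpace ℝ (Fin n) → (Fin n → ℝ)) g := by fun_prop
  have hv' : ∀ i, MemLp (fun x : EuclideanSpace ℝ (Fin n) => x i) 2 g := fun i =>
    (EuclideanSpace.proj (𝕜 := ℝ) i).comp_memLp' IsGaussian.memLp_two_id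
  have hmean' : ∀ i, ∫ x, x i ∂g = 0 := fun i => by
    have h1 := (EuclideanSpace.proj (𝕜 := ℝ) i).integral_comp_comm
      (φ := fun x : EuclideanSpace ℝ (Fin n) => x) (μ := g) IsGaussian.integrable_fun_id
    simpa [hg] using h1
  have hv : ∀ i, MemLp (fun v : Fin n → ℝ => v i) 2 (noiseLaw S) := fun i =>
    (memLp_map_measure_iff (measurable_pi_apply i).aestronglyMeasurable hmap).2 (hv' i)
  have hmean : ∀ i, ∫ v, v i ∂(noiseLaw S) = 0 := fun i => by
    rw [noiseLaw, integral_map hmap (measurable_pi_apply i).aestronglyMeasurable]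
    exact hmean' i
  have hcov : ∀ i j, ∫ v, v i * v j ∂(noiseLaw S) = S i j := fun i j => by
    rw [noiseLaw, integral_map hmap (by fun_prop), ← covariance_eval_multivariateGaussian
      (μ := 0) hS i j, covariance, ← hg, hmean', hmean']
    simp only [sub_zero]
  have hi1 : ∀ i, Integrable (fun v : Fin n → ℝ => v i) (noiseLaw S) := fun i =>
    (hv i).integrable one_le_two
  have hi2 : ∀ i j, Integrable (fun v : Fin n → ℝ => v i * v j) (noiseLaw S) := fun i j =>
    (hv i).integrable_mul (hv j)
  have hPt := transpose_eq_of_posSemidef hP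
  have hexp : ∀ v : Fin n → ℝ, c + (y + v) ⬝ᵥ P *ᵥ (y + v)
      = (c + y ⬝ᵥ P *ᵥ y) + (∑ i, 2 * (P *ᵥ y) i * v i + ∑ i, ∑ j, P j i * (v i * v j)) := fun v => by
    have e1 : y ⬝ᵥ P *ᵥ v = v ⬝ᵥ P *ᵥ y := by
      rw [dotProduct_mulVec, ← mulVec_transpose, hPt, dotProduct_comm]
    have e2 : v ⬝ᵥ P *ᵥ v = ∑ i, ∑ j, P j i * (v i * v j) := by
      simp only [dotProduct, mulVec, Finset.mul_sum]
      rw [Finset.sum_comm]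
      exact Finset.sum_congr rfl fun i _ => Finset.sum_congr rfl fun j _ => by ring
    have e3 : v ⬝ᵥ P *ᵥ y = ∑ i, (P *ᵥ y) i * v i := by
      simp only [dotProduct, mul_comm]
    rw [← e2, mulVec_add, add_dotProduct, dotProduct_add, dotProduct_add, e1, e3]
    simp only [mul_assoc, ← Finset.mul_sum]
    ring
  have hI1 : Integrable (fun v : Fin n → ℝ => ∑ i, 2 * (P *ᵥ y) i * v i) (noiseLaw S) :=
    integrable_finsetSum _ fun i _ => (hi1 i).const_mul _
  have hI2 : Integrable (fun v : Fin n → ℝ => ∑ i, ∑ j, P j i * (v i * v j)) (noiseLaw S) :=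
    integrable_finsetSum _ fun i _ => integrable_finsetSum _ fun j _ => (hi2 i j).const_mul _
  have hE1 : ∫ v, ∑ i, 2 * (P *ᵥ y) i * v i ∂(noiseLaw S) = 0 := by
    rw [integral_finsetSum _ fun i _ => (hi1 i).const_mul _]
    simp only [integral_const_mul, hmean, mul_zero, Finset.sum_const_zero]
  have hE2 : ∫ v, ∑ i, ∑ j, P j i * (v i * v j) ∂(noiseLaw S) = (S * P).trace := by
    rw [integral_finsetSum _ fun i _ => integrable_finsetSum _ fun j _ => (hi2 i j).const_mul _,
      trace]
    refine Finset.sum_congr rfl fun i _ => ?_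
    rw [integral_finsetSum _ fun j _ => (hi2 i j).const_mul _]
    simp only [integral_const_mul, hcov, diag_apply, Matrix.mul_apply, mul_comm]
  have hI := hI1.add hI2
  have hint : Integrable (fun v : Fin n → ℝ => c + (y + v) ⬝ᵥ P *ᵥ (y + v)) (noiseLaw S) :=
    ((integrable_const (c + y ⬝ᵥ P *ᵥ y)).add hI).congr
      (Eventually.of_forall fun v => (hexp v).symm)
  rw [← ofReal_integral_eq_lintegral_ofReal hint
    (Eventually.of_forall fun v => add_nonneg hc (dotProduct_mulVec_nonneg hP _))]
  congr 1
  calc ∫ v, c + (y + v) ⬝ᵥ P *ᵥ (y + v) ∂(noiseLaw S)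
      = ∫ v, ((c + y ⬝ᵥ P *ᵥ y) + (∑ i, 2 * (P *ᵥ y) i * v i
          + ∑ i, ∑ j, P j i * (v i * v j))) ∂(noiseLaw S) := by simp only [hexp]
    _ = c + y ⬝ᵥ P *ᵥ y + (S * P).trace := by
      refine (integral_add (integrable_const _) hI).trans ?_
      congr 1
      · simp
      · exact (integral_add hI1 hI2).trans (by rw [hE1, hE2, zero_add])

end Noise

/-! ### The controlled process -/

section Controlled

variable {n m : ℕ} {A : Matrix (Fin n) (Fin n) ℝ} {B : Matrix (Fin n) (Fin m) ℝ}
  {γ : ControlStrategy n m} {β : AttackPolicy} {a₀ : Bool}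

theorem state_succ (ω : Sample n) (t : ℕ) :
    state A B γ β ω (t + 1) = A *ᵥ state A B γ β ω t
      + delivered β ω t • (B *ᵥ controlInput A B γ β ω t) + ω.2.2 t := by
  simp [state, history, controlInput]

theorem pastTx_congr {ω ω' : Sample n} {t : ℕ} (hα : ∀ i < t, ω.2.1 i = ω'.2.1 i) :
    pastTx ω t = pastTx ω' t :=
  funext fun i => hα i i.2

/-- The states up to time `t` depend only on decisions and noise before time `t`. -/
theorem history_congr {ω ω' : Sample n} (h0 : ω.1 = ω'.1) :
    ∀ {t : ℕ}, (∀ i < t, ω.2.1 i = ω'.2.1 i) → (∀ i < t, ω.2.2 i = ω'.2.2 i) →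
      history A B γ β ω t = history A B γ β ω' t
  | 0, _, _ => by simp [history, h0]
  | t + 1, hα, hv => by
    have ih := history_congr h0 (fun i hi => hα i (hi.trans t.lt_succ_self))
      (fun i hi => hv i (hi.trans t.lt_succ_self))
    have hp := pastTx_congr (ω := ω) (ω' := ω') (t := t) fun i hi => hα i (hi.trans t.lt_succ_self)
    simp only [history, delivered, ih, hp, hα t t.lt_succ_self, hv t t.lt_succ_self]

section Resample

variable (ω : Sample n) (t : ℕ) (a : Bool) (v : Fin n → ℝ)

theorem pastTx_resample : pastTx (resample ω t a v) t = pastTx ω t :=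
  pastTx_congr fun _ hi => Function.update_of_ne hi.ne _ _

theorem history_resample :
    history A B γ β (resample ω t a v) t = history A B γ β ω t :=
  history_congr (ω := resample ω t a v) (ω' := ω) rfl
    (fun _ hi => Function.update_of_ne hi.ne _ _)
    (fun _ hi => Function.update_of_ne hi.ne _ _)

theorem state_resample : state A B γ β (resample ω t a v) t = state A B γ β ω t := by
  rw [state, history_resample, state]

theorem controlInput_resample :
    controlInput A B γ β (resample ω t a v) t = controlInput A B γ β ω t := by
  rw [controlInput, history_resample, pastTx_resample, controlInput]

theorem delivered_resample : delivered β (resample ω t a v) t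
    = (1 - num (β t (pastTx ω t))) * num a := by
  rw [delivered, pastTx_resample]
  simp [resample]

theorem state_succ_resample : state A B γ β (resample ω t a v) (t + 1)
    = A *ᵥ state A B γ β ω t + ((1 - num (β t (pastTx ω t))) * num a) •
      (B *ᵥ controlInput A B γ β ω t) + v := by
  rw [state_succ, state_resample, controlInput_resample, delivered_resample]
  simp [resample]

theorem followAttack_succ (ω : Sample n) :
    followAttack a₀ (t + 1) (pastTx ω (t + 1)) = ω.2.1 t := rfl

end Resample

theorem measurable_pastTx (t : ℕ) : Measurable fun ω : Sample n => pastTx ω t :=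
  measurable_pi_iff.2 fun i =>
    (measurable_pi_apply (i : ℕ)).comp (measurable_fst.comp measurable_snd)

theorem measurable_num : Measurable num := measurable_of_countable _

theorem measurable_delivered (t : ℕ) : Measurable fun ω : Sample n => delivered β ω t := by
  have h1 : Measurable fun ω : Sample n => num (β t (pastTx ω t)) :=
    measurable_num.comp ((measurable_of_countable (β t)).comp (measurable_pastTx t))
  have h2 : Measurable fun ω : Sample n => num (ω.2.1 t) :=
    measurable_num.comp ((measurable_pi_apply t).comp (measurable_fst.comp measurable_snd))
  exact (h1.const_sub 1).mul h2

theorem measurable_mulVec {k l : ℕ} (M : Matrix (Fin k) (Fin l) ℝ) :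
    Measurable fun x : Fin l → ℝ => M *ᵥ x :=
  (Continuous.matrix_mulVec continuous_const continuous_id).measurable

theorem measurable_history : ∀ t : ℕ, Measurable fun ω : Sample n => history A B γ β ω t
  | 0 => measurable_pi_iff.2 fun _ => measurable_fst
  | t + 1 => by
    have ih := measurable_history t
    refine measurable_pi_iff.2 fun i => ?_
    refine Fin.lastCases ?_ (fun j => ?_) i
    · simp only [history, Fin.snoc_last]
      have h1 : Measurable fun ω : Sample n => history A B γ β ω t (Fin.last t) :=
        (measurable_pi_apply _).comp ih
      have h2 : Measurable fun ω : Sample n => γ.act t (history A B γ β ω t) (pastTx ω t) :=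
        (γ.measurable_act t).comp (ih.prodMk (measurable_pastTx t))
      have h3 : Measurable fun ω : Sample n => ω.2.2 t :=
        (measurable_pi_apply t).comp (measurable_snd.comp measurable_snd)
      exact (((measurable_mulVec A).comp h1).add
        ((measurable_delivered t).smul ((measurable_mulVec B).comp h2))).add h3
    · simp only [history, Fin.snoc_castSucc]
      exact (measurable_pi_apply j).comp ih

theorem measurable_state (t : ℕ) : Measurable fun ω : Sample n => state A B γ β ω t :=
  (measurable_pi_apply _).comp (measurable_history t)

theorem measurable_controlInput (t : ℕ) :
    Measurable fun ω : Sample n => controlInput A B γ β ω t :=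
  (γ.measurable_act t).comp ((measurable_history t).prodMk (measurable_pastTx t))

theorem measurable_quadratic {k : ℕ} (M : Matrix (Fin k) (Fin k) ℝ) :
    Measurable fun x : Fin k → ℝ => x ⬝ᵥ M *ᵥ x :=
  (Continuous.dotProduct continuous_id
    (Continuous.matrix_mulVec continuous_const continuous_id)).measurable

theorem delivered_nonneg (ω : Sample n) (t : ℕ) : 0 ≤ delivered β ω t := by
  rw [delivered, num, num]
  split_ifs <;> norm_num

variable {Q : Matrix (Fin n) (Fin n) ℝ} {R : Matrix (Fin m) (Fin m) ℝ}

theorem stageCost_nonneg (hQ : Q.PosSemidef) (hR : R.PosSemidef) (ω : Sample n) (t : ℕ) :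
    0 ≤ stageCost A B γ β ω Q R t :=
  add_nonneg (dotProduct_mulVec_nonneg hQ _)
    (mul_nonneg (delivered_nonneg ω t) (dotProduct_mulVec_nonneg hR _))

theorem measurable_stageCost (t : ℕ) :
    Measurable fun ω : Sample n => stageCost A B γ β ω Q R t :=
  ((measurable_quadratic Q).comp (measurable_state t)).add
    ((measurable_delivered t).mul ((measurable_quadratic R).comp (measurable_controlInput t)))

end Controlled

/-! ### Expected costs -/

section Expected

variable {n m : ℕ} (A : Matrix (Fin n) (Fin n) ℝ) (B : Matrix (Fin n) (Fin m) ℝ)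
  (Q : Matrix (Fin n) (Fin n) ℝ) (R : Matrix (Fin m) (Fin m) ℝ) (μ : Measure (Sample n))
  (γ : ControlStrategy n m) (a₀ : Bool)

/-- The expected stage cost of time `t` under the following attack. -/
noncomputable def expStage (t : ℕ) : ℝ≥0∞ :=
  ∫⁻ ω, ENNReal.ofReal (stageCost A B γ (followAttack a₀) ω Q R t) ∂μ

/-- The expectation of `x_tᵀ P x_t`, where the matrix `P` depends on the jamming decision of
time `t`. -/
noncomputable def expForm (P : Bool → Matrix (Fin n) (Fin n) ℝ) (t : ℕ) : ℝ≥0∞ :=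
  ∫⁻ ω, ENNReal.ofReal (state A B γ (followAttack a₀) ω t ⬝ᵥ
    P (followAttack a₀ t (pastTx ω t)) *ᵥ state A B γ (followAttack a₀) ω t) ∂μ

variable {A B Q R μ γ a₀} {P : Bool → Matrix (Fin n) (Fin n) ℝ}

theorem measurable_expForm (t : ℕ) : Measurable fun ω : Sample n =>
    state A B γ (followAttack a₀) ω t ⬝ᵥ
      P (followAttack a₀ t (pastTx ω t)) *ᵥ state A B γ (followAttack a₀) ω t := by
  have h : Measurable fun z : Bool × (Fin n → ℝ) => z.2 ⬝ᵥ P z.1 *ᵥ z.2 :=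
    measurable_from_prod_countable_right fun b => measurable_quadratic (P b)
  exact h.comp (((measurable_of_countable (followAttack a₀ t)).comp (measurable_pastTx t)).prodMk
    (measurable_state t))

theorem finiteCost_eq (hQ : Q.PosSemidef) (hR : R.PosSemidef) (N : ℕ) :
    finiteCost A B Q R μ γ (followAttack a₀) N
      = ∑ t ∈ Finset.range N, expStage A B Q R μ γ a₀ t + expForm A B μ γ a₀ (fun _ => Q) N := by
  rw [finiteCost, expForm, add_comm]
  simp only [expStage]
  rw [← lintegral_finsetSum _ fun t _ => (measurable_stageCost t).ennreal_ofReal]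
  refine Eq.trans ?_ (lintegral_add_left
    ((measurable_quadratic Q).comp (measurable_state N)).ennreal_ofReal _)
  refine lintegral_congr fun ω => ?_
  refine (ENNReal.ofReal_add (dotProduct_mulVec_nonneg hQ _)
    (Finset.sum_nonneg fun t _ => stageCost_nonneg hQ hR ω t)).trans ?_
  rw [ENNReal.ofReal_sum_of_nonneg fun t _ => stageCost_nonneg hQ hR ω t]
  rfl

theorem averageCost_eq (hQ : Q.PosSemidef) (hR : R.PosSemidef) :
    averageCost A B Q R μ γ (followAttack a₀)
      = limsup (fun N : ℕ => (N : ℝ≥0∞)⁻¹ * ∑ t ∈ Finset.range N, expStage A B Q R μ γ a₀ t)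
        atTop := by
  rw [averageCost]
  congr 1
  funext N
  simp only [expStage]
  rw [← lintegral_finsetSum _ fun t _ => (measurable_stageCost t).ennreal_ofReal]
  congr 1
  refine lintegral_congr fun ω => ?_
  rw [ENNReal.ofReal_sum_of_nonneg fun t _ => stageCost_nonneg hQ hR ω t]

end Expected

/-! ### One step of dynamic programming -/

section StepCost

variable {ι κ : Type*} [Fintype ι] [Fintype κ]
  (A Q : Matrix ι ι ℝ) (B : Matrix ι κ ℝ) (R : Matrix κ κ ℝ) (p : ℝ)
  (P : Bool → Matrix ι ι ℝ)

/-- The conditional expectation of stage cost plus cost-to-go, up to the contribution of the noise,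
in the state `x` with control `u`, if the jamming decision is `s` and the cost-to-go of the next
state is given by `P`. -/
def stepCost (s : Bool) (x : ι → ℝ) (u : κ → ℝ) : ℝ :=
  x ⬝ᵥ Q *ᵥ x + if s then (A *ᵥ x) ⬝ᵥ modeMean p P *ᵥ (A *ᵥ x) else
    (1 - p) * ((A *ᵥ x) ⬝ᵥ P false *ᵥ (A *ᵥ x))
      + p * ((A *ᵥ x + B *ᵥ u) ⬝ᵥ P true *ᵥ (A *ᵥ x + B *ᵥ u) + u ⬝ᵥ R *ᵥ u)

variable {A Q B R p P}

theorem dotProduct_closedLoop (P : Matrix ι ι ℝ) (K : Matrix κ ι ℝ) (x : ι → ℝ) :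
    x ⬝ᵥ closedLoop A P B R K *ᵥ x
      = (A *ᵥ x + B *ᵥ (K *ᵥ x)) ⬝ᵥ P *ᵥ (A *ᵥ x + B *ᵥ (K *ᵥ x))
        + (K *ᵥ x) ⬝ᵥ R *ᵥ (K *ᵥ x) := by
  rw [closedLoop, add_mulVec, dotProduct_add, dotProduct_transpose_mul_mul,
    dotProduct_transpose_mul_mul]
  simp only [add_mulVec, ← mulVec_mulVec]

variable [DecidableEq κ]

theorem dotProduct_riccati (s : Bool) (x : ι → ℝ) :
    x ⬝ᵥ riccati A Q B R p P s *ᵥ x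
      = stepCost A Q B R p P s x (optGain A (P true) B R *ᵥ x) := by
  cases s
  · rw [riccati, stepCost, if_neg (by simp), add_mulVec, add_mulVec, dotProduct_add, dotProduct_add,
      smul_mulVec, smul_mulVec, dotProduct_smul, dotProduct_smul, dotProduct_closedLoop,
      dotProduct_transpose_mul_mul]
    rfl
  · rw [riccati, stepCost, if_pos rfl, add_mulVec, dotProduct_add, dotProduct_transpose_mul_mul]

theorem dotProduct_riccati_le (hP : ∀ b, (P b).PosSemidef) (hR : R.PosDef) (hp : 0 ≤ p)
    (s : Bool) (x : ι → ℝ) (u : κ → ℝ) :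
    x ⬝ᵥ riccati A Q B R p P s *ᵥ x ≤ stepCost A Q B R p P s x u := by
  rw [dotProduct_riccati]
  cases s
  · simp only [stepCost, Bool.false_eq_true, if_false]
    refine add_le_add_right (add_le_add_right (mul_le_mul_of_nonneg_left ?_ hp) _) _
    rw [← dotProduct_closedLoop]
    rcases eq_or_ne x 0 with rfl | hx
    · simp only [mulVec_zero, dotProduct_zero]
      exact add_nonneg (dotProduct_mulVec_nonneg (hP _) _)
        (dotProduct_mulVec_nonneg hR.posSemidef _)
    · -- The control `u` is the value at `x ≠ 0` of a linear feedback of rank one.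
      set K : Matrix κ ι ℝ := (x ⬝ᵥ x)⁻¹ • vecMulVec u x with hK
      have hKx : K *ᵥ x = u := by
        rw [hK, smul_mulVec, vecMulVec_mulVec]
        ext i
        have : x ⬝ᵥ x ≠ 0 := fun h => hx (dotProduct_self_eq_zero.1 h)
        simp
        field_simp
      have h := dotProduct_mulVec_mono
        (closedLoop_optGain_le (A := A) (B := B) (K := K) (hP true) hR) x
      rwa [dotProduct_closedLoop _ K, hKx] at h
  · simp [stepCost]

end StepCost

section OneStep

variable {n m : ℕ} {A : Matrix (Fin n) (Fin n) ℝ} {B : Matrix (Fin n) (Fin m) ℝ}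
  {Q : Matrix (Fin n) (Fin n) ℝ} {R : Matrix (Fin m) (Fin m) ℝ} {S : Matrix (Fin n) (Fin n) ℝ}
  {μ₀ : Measure (Fin n → ℝ)} [IsProbabilityMeasure μ₀] {p : unitInterval} {a₀ : Bool}
  {γ : ControlStrategy n m} {P : Bool → Matrix (Fin n) (Fin n) ℝ}

/-- Conditioning on the past of time `t`: the decision and the noise of time `t` are integrated
out, the latter at the cost of the constant `tr (S M)`. -/
theorem expStage_add_expForm_succ (hQ : Q.PosSemidef) (hR : R.PosDef) (hS : S.PosSemidef)
    (hP : ∀ b, (P b).PosSemidef) (t : ℕ) :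
    expStage A B Q R (sampleLaw μ₀ p S) γ a₀ t + expForm A B (sampleLaw μ₀ p S) γ a₀ P (t + 1)
      = ∫⁻ ω, ENNReal.ofReal (stepCost A Q B R p P (followAttack a₀ t (pastTx ω t))
          (state A B γ (followAttack a₀) ω t) (controlInput A B γ (followAttack a₀) ω t)
          + (S * modeMean p P).trace) ∂(sampleLaw μ₀ p S) := by
  have hp := p.2.1
  have hp1 := p.2.2
  have hm1 := (measurable_stageCost (A := A) (B := B) (γ := γ) (β := followAttack a₀) (Q := Q)
    (R := R) t).ennreal_ofReal
  have hm2 := (measurable_expForm (A := A) (B := B) (γ := γ) (a₀ := a₀) (P := P)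
    (t + 1)).ennreal_ofReal
  rw [expStage, expForm]
  refine (lintegral_add_left hm1 _).symm.trans ?_
  refine (lintegral_sampleLaw μ₀ p t (hm1.add hm2)).trans ?_
  refine lintegral_congr fun ω => ?_
  obtain ⟨x, hx⟩ : ∃ x, x = state A B γ (followAttack a₀) ω t := ⟨_, rfl⟩
  obtain ⟨u, hu⟩ : ∃ u, u = controlInput A B γ (followAttack a₀) ω t := ⟨_, rfl⟩
  obtain ⟨s, hs⟩ : ∃ s, s = followAttack a₀ t (pastTx ω t) := ⟨_, rfl⟩
  have hd : ∀ a, 0 ≤ (1 - num s) * num a := fun a => by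
    rw [num, num]; split_ifs <;> norm_num
  have hc : ∀ a, 0 ≤ x ⬝ᵥ Q *ᵥ x + (1 - num s) * num a * (u ⬝ᵥ R *ᵥ u) := fun a =>
    add_nonneg (dotProduct_mulVec_nonneg hQ _)
      (mul_nonneg (hd a) (dotProduct_mulVec_nonneg hR.posSemidef _))
  have key : ∀ a : Bool, ∫⁻ v, ENNReal.ofReal
        (stageCost A B γ (followAttack a₀) (resample ω t a v) Q R t)
      + ENNReal.ofReal (state A B γ (followAttack a₀) (resample ω t a v) (t + 1) ⬝ᵥ
        P (followAttack a₀ (t + 1) (pastTx (resample ω t a v) (t + 1))) *ᵥ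
          state A B γ (followAttack a₀) (resample ω t a v) (t + 1)) ∂(noiseLaw S)
      = ENNReal.ofReal (x ⬝ᵥ Q *ᵥ x + (1 - num s) * num a * (u ⬝ᵥ R *ᵥ u)
        + (A *ᵥ x + ((1 - num s) * num a) • (B *ᵥ u)) ⬝ᵥ P a *ᵥ
          (A *ᵥ x + ((1 - num s) * num a) • (B *ᵥ u)) + (S * P a).trace) := fun a => by
    rw [← lintegral_noise_quadratic hS (hP a) (hc a)]
    refine lintegral_congr fun v => ?_
    rw [stageCost, state_succ_resample, state_resample, controlInput_resample, delivered_resample,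
      followAttack_succ, ← hx, ← hu, ← hs,
      ← ENNReal.ofReal_add (hc a) (dotProduct_mulVec_nonneg (hP _) _)]
    simp [resample]
  have hnn : ∀ a, 0 ≤ x ⬝ᵥ Q *ᵥ x + (1 - num s) * num a * (u ⬝ᵥ R *ᵥ u)
        + (A *ᵥ x + ((1 - num s) * num a) • (B *ᵥ u)) ⬝ᵥ P a *ᵥ
          (A *ᵥ x + ((1 - num s) * num a) • (B *ᵥ u)) + (S * P a).trace := fun a =>
    add_nonneg (add_nonneg (hc a) (dotProduct_mulVec_nonneg (hP a) _)) (trace_mul_nonneg hS (hP a))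
  rw [← hx, ← hu, ← hs]
  refine (congrArg₂ (fun a b => ENNReal.ofReal p * a + ENNReal.ofReal (1 - p) * b)
    (key true) (key false)).trans ?_
  rw [← ENNReal.ofReal_mul hp, ← ENNReal.ofReal_mul (sub_nonneg.2 hp1),
    ← ENNReal.ofReal_add (mul_nonneg hp (hnn _)) (mul_nonneg (sub_nonneg.2 hp1) (hnn _))]
  congr 1
  have htr : (S * modeMean (p : ℝ) P).trace
      = p * (S * P true).trace + (1 - p) * (S * P false).trace := by
    rw [modeMean, Matrix.mul_add, Matrix.mul_smul, Matrix.mul_smul, trace_add, trace_smul,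
      trace_smul, smul_eq_mul, smul_eq_mul]
  rw [htr]
  cases s
  · simp only [stepCost, num, Bool.false_eq_true, if_false, if_true, sub_zero, one_mul, one_smul,
      mul_zero, zero_mul, zero_smul, add_zero]
    ring
  · simp only [stepCost, num, if_true, sub_self, zero_mul, zero_smul, add_zero, modeMean,
      add_mulVec, smul_mulVec, dotProduct_add, dotProduct_smul, smul_eq_mul]
    ring

theorem expForm_riccati_add (hQ : Q.PosSemidef) (hR : R.PosDef) (hS : S.PosSemidef)
    (hP : ∀ b, (P b).PosSemidef) (t : ℕ) :
    expForm A B (sampleLaw μ₀ p S) γ a₀ (riccati A Q B R p P) t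
        + ENNReal.ofReal (S * modeMean p P).trace
      = ∫⁻ ω, ENNReal.ofReal (state A B γ (followAttack a₀) ω t ⬝ᵥ
          riccati A Q B R p P (followAttack a₀ t (pastTx ω t)) *ᵥ
            state A B γ (followAttack a₀) ω t + (S * modeMean p P).trace) ∂(sampleLaw μ₀ p S) := by
  have hp := p.2.1
  have hp1 := p.2.2
  have hconst : ∫⁻ _, ENNReal.ofReal (S * modeMean p P).trace ∂(sampleLaw μ₀ p S)
      = ENNReal.ofReal (S * modeMean p P).trace := by simp
  rw [← hconst, expForm]
  refine (lintegral_add_left (measurable_expForm t).ennreal_ofReal _).symm.trans ?_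
  refine lintegral_congr fun ω => ?_
  rw [← ENNReal.ofReal_add (dotProduct_mulVec_nonneg (riccati_posSemidef hQ hR hp hp1 hP _) _)
    (trace_mul_nonneg hS (modeMean_posSemidef hp hp1 hP))]

/-- Dynamic programming inequality: no control beats one step of the Riccati recursion. -/
theorem expForm_riccati_add_le (hQ : Q.PosSemidef) (hR : R.PosDef) (hS : S.PosSemidef)
    (hP : ∀ b, (P b).PosSemidef) (t : ℕ) :
    expForm A B (sampleLaw μ₀ p S) γ a₀ (riccati A Q B R p P) t
        + ENNReal.ofReal (S * modeMean p P).trace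
      ≤ expStage A B Q R (sampleLaw μ₀ p S) γ a₀ t
        + expForm A B (sampleLaw μ₀ p S) γ a₀ P (t + 1) := by
  rw [expForm_riccati_add hQ hR hS hP, expStage_add_expForm_succ hQ hR hS hP]
  exact lintegral_mono fun ω => ENNReal.ofReal_le_ofReal
    (add_le_add_left (dotProduct_riccati_le hP hR p.2.1 _ _ _) _)

/-- The feedback `optGain` attains equality in the dynamic programming inequality. -/
theorem expForm_riccati_add_eq (hQ : Q.PosSemidef) (hR : R.PosDef) (hS : S.PosSemidef)
    (hP : ∀ b, (P b).PosSemidef) (t : ℕ)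
    (hγ : ∀ x a, γ.act t x a = optGain A (P true) B R *ᵥ x (Fin.last t)) :
    expForm A B (sampleLaw μ₀ p S) γ a₀ (riccati A Q B R p P) t
        + ENNReal.ofReal (S * modeMean p P).trace
      = expStage A B Q R (sampleLaw μ₀ p S) γ a₀ t
        + expForm A B (sampleLaw μ₀ p S) γ a₀ P (t + 1) := by
  rw [expForm_riccati_add hQ hR hS hP, expStage_add_expForm_succ hQ hR hS hP]
  refine lintegral_congr fun ω => ?_
  rw [dotProduct_riccati, controlInput, hγ]
  rfl

end OneStep

/-! ### Optimal strategies -/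

/-- A finite second moment of the initial state makes the initial cost-to-go finite. -/
theorem expForm_zero_lt_top {n m : ℕ} {A : Matrix (Fin n) (Fin n) ℝ} {B : Matrix (Fin n) (Fin m) ℝ}
    {S : Matrix (Fin n) (Fin n) ℝ} {μ₀ : Measure (Fin n → ℝ)} {p : unitInterval} {a₀ : Bool}
    {γ : ControlStrategy n m} {P : Bool → Matrix (Fin n) (Fin n) ℝ} (hμ₀ : MemLp id 2 μ₀) :
    expForm A B (sampleLaw μ₀ p S) γ a₀ P 0 < ⊤ := by
  have hi : ∀ i, MemLp (fun x : Fin n → ℝ => x i) 2 μ₀ := fun i =>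
    (ContinuousLinearMap.proj (R := ℝ) (φ := fun _ : Fin n => ℝ) i).comp_memLp' hμ₀
  have hint : Integrable (fun x : Fin n → ℝ => x ⬝ᵥ P a₀ *ᵥ x) μ₀ := by
    simp only [dotProduct, mulVec, Finset.mul_sum]
    refine integrable_finsetSum _ fun i _ => integrable_finsetSum _ fun j _ => ?_
    refine (((hi i).integrable_mul (hi j)).const_mul (P a₀ i j)).congr
      (Eventually.of_forall fun x => ?_)
    simp only [Pi.mul_apply]
    ring
  have hmp : MeasurePreserving (Prod.fst : Sample n → Fin n → ℝ) (sampleLaw μ₀ p S) μ₀ :=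
    measurePreserving_fst
  have h := hmp.lintegral_comp (measurable_quadratic (P a₀)).ennreal_ofReal
  refine lt_of_eq_of_lt h ?_
  exact hint.lintegral_lt_top

section Optimal

variable {n m : ℕ} {A : Matrix (Fin n) (Fin n) ℝ} {B : Matrix (Fin n) (Fin m) ℝ}
  {Q : Matrix (Fin n) (Fin n) ℝ} {R : Matrix (Fin m) (Fin m) ℝ} {S : Matrix (Fin n) (Fin n) ℝ}
  {μ₀ : Measure (Fin n → ℝ)} [IsProbabilityMeasure μ₀] {p : unitInterval} {a₀ : Bool}
  {γ : ControlStrategy n m} {P : Bool → Matrix (Fin n) (Fin n) ℝ}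

theorem iterate_riccati_posSemidef (hQ : Q.PosSemidef) (hR : R.PosDef)
    (hP : ∀ b, (P b).PosSemidef) (k : ℕ) (b : Bool) :
    ((riccati A Q B R p)^[k] P b).PosSemidef := by
  induction k generalizing b with
  | zero => exact hP b
  | succ k ih =>
    rw [Function.iterate_succ_apply']
    exact riccati_posSemidef hQ hR p.2.1 p.2.2 ih b

/-- The value of the `N`-stage problem bounds the cost of every strategy from below. -/
theorem value_le (hQ : Q.PosSemidef) (hR : R.PosDef) (hS : S.PosSemidef)
    (hP : ∀ b, (P b).PosSemidef) (N : ℕ) :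
    expForm A B (sampleLaw μ₀ p S) γ a₀ ((riccati A Q B R p)^[N] P) 0
        + ∑ k ∈ Finset.range N,
          ENNReal.ofReal (S * modeMean p ((riccati A Q B R p)^[k] P)).trace
      ≤ ∑ t ∈ Finset.range N, expStage A B Q R (sampleLaw μ₀ p S) γ a₀ t
        + expForm A B (sampleLaw μ₀ p S) γ a₀ P N := by
  induction N generalizing P with
  | zero => simp
  | succ N ih =>
    have h1 := ih (P := riccati A Q B R p P)
      (fun b => riccati_posSemidef hQ hR p.2.1 p.2.2 hP b)
    have h2 := expForm_riccati_add_le (A := A) (B := B) (μ₀ := μ₀) (p := p) (a₀ := a₀) (γ := γ)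
      hQ hR hS hP N
    rw [Finset.sum_range_succ', Finset.sum_range_succ, add_assoc (Finset.sum _ _)]
    simp only [Function.iterate_succ_apply, Function.iterate_zero, id]
    rw [← add_assoc]
    refine (add_le_add_left h1 _).trans ?_
    rw [add_assoc]
    exact add_le_add_right h2 _

/-- The linear feedbacks of the Riccati recursion attain the value of the `N`-stage problem. -/
theorem value_eq (hQ : Q.PosSemidef) (hR : R.PosDef) (hS : S.PosSemidef)
    (hP : ∀ b, (P b).PosSemidef) (N : ℕ)
    (hγ : ∀ t < N, ∀ x a, γ.act t x a
      = optGain A ((riccati A Q B R p)^[N - 1 - t] P true) B R *ᵥ x (Fin.last t)) :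
    expForm A B (sampleLaw μ₀ p S) γ a₀ ((riccati A Q B R p)^[N] P) 0
        + ∑ k ∈ Finset.range N,
          ENNReal.ofReal (S * modeMean p ((riccati A Q B R p)^[k] P)).trace
      = ∑ t ∈ Finset.range N, expStage A B Q R (sampleLaw μ₀ p S) γ a₀ t
        + expForm A B (sampleLaw μ₀ p S) γ a₀ P N := by
  induction N generalizing P with
  | zero => simp
  | succ N ih =>
    have h1 := ih (P := riccati A Q B R p P)
      (fun b => riccati_posSemidef hQ hR p.2.1 p.2.2 hP b) fun t ht x a => by
        have e : N + 1 - 1 - t = N - 1 - t + 1 := by omega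
        rw [hγ t (ht.trans N.lt_succ_self), e, Function.iterate_succ_apply]
    have h2 := expForm_riccati_add_eq (A := A) (B := B) (μ₀ := μ₀) (p := p) (a₀ := a₀) (γ := γ)
      hQ hR hS hP N fun x a => by simpa using hγ N N.lt_succ_self x a
    rw [Finset.sum_range_succ', Finset.sum_range_succ, add_assoc (Finset.sum _ _)]
    simp only [Function.iterate_succ_apply, Function.iterate_zero, id]
    rw [← add_assoc, h1, add_assoc, h2]

theorem expForm_zero (γ γ' : ControlStrategy n m) (μ : Measure (Sample n)) :
    expForm A B μ γ a₀ P 0 = expForm A B μ γ' a₀ P 0 := rfl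

/-- The strategy `u_t = K_t x_t`. -/
def linearStrategy (K : ℕ → Matrix (Fin m) (Fin n) ℝ) : ControlStrategy n m where
  act t x _ := K t *ᵥ x (Fin.last t)
  measurable_act t :=
    (measurable_mulVec (K t)).comp ((measurable_pi_apply (Fin.last t)).comp measurable_fst)

theorem exists_finiteCost_optimal (hQ : Q.PosSemidef) (hR : R.PosDef) (hS : S.PosSemidef)
    (N : ℕ) :
    ∃ K : ℕ → Matrix (Fin m) (Fin n) ℝ, ∀ γ : ControlStrategy n m,
      finiteCost A B Q R (sampleLaw μ₀ p S) (linearStrategy K) (followAttack a₀) N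
        ≤ finiteCost A B Q R (sampleLaw μ₀ p S) γ (followAttack a₀) N := by
  refine ⟨fun t => optGain A ((riccati A Q B R p)^[N - 1 - t] (fun _ => Q) true) B R, fun γ => ?_⟩
  rw [finiteCost_eq hQ hR.posSemidef, finiteCost_eq hQ hR.posSemidef,
    ← value_eq hQ hR hS (fun _ => hQ) N fun t _ x a => rfl, expForm_zero _ γ]
  exact value_le hQ hR hS (fun _ => hQ) N

/-- The stationary feedback of a fixed point has cost `e₀ + N ℓ` at most over `N` stages. -/
theorem averageCost_le_of_fixedPoint (hQ : Q.PosSemidef) (hR : R.PosDef) (hS : S.PosSemidef)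
    (hμ₀ : MemLp id 2 μ₀) (hP : ∀ b, (P b).PosSemidef) (hfix : riccati A Q B R p P = P) :
    averageCost A B Q R (sampleLaw μ₀ p S) (linearStrategy fun _ => optGain A (P true) B R)
        (followAttack a₀)
      ≤ ENNReal.ofReal (S * modeMean p P).trace := by
  set K : Matrix (Fin m) (Fin n) ℝ := optGain A (P true) B R
  set ℓ := ENNReal.ofReal (S * modeMean p P).trace
  set e₀ := expForm A B (sampleLaw μ₀ p S) (linearStrategy fun _ => K) a₀ P 0
  have he₀ : e₀ ≠ ⊤ := (expForm_zero_lt_top hμ₀).ne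
  have hiter : ∀ k, (riccati A Q B R p)^[k] P = P := Function.iterate_fixed hfix
  have hval : ∀ N : ℕ, ∑ t ∈ Finset.range N,
      expStage A B Q R (sampleLaw μ₀ p S) (linearStrategy fun _ => K) a₀ t ≤ e₀ + N * ℓ := by
    intro N
    have h := value_eq (A := A) (B := B) (μ₀ := μ₀) (p := p) (a₀ := a₀)
      (γ := linearStrategy fun _ => K) hQ hR hS hP N fun t _ x a => by rw [hiter]; rfl
    simp only [hiter, Finset.sum_const, Finset.card_range, nsmul_eq_mul] at h
    rw [h]
    exact le_self_add
  have hlim : Tendsto (fun N : ℕ => (N : ℝ≥0∞)⁻¹ * e₀ + ℓ) atTop (nhds ℓ) := by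
    have h := ENNReal.Tendsto.mul_const (b := e₀) ENNReal.tendsto_inv_nat_nhds_zero (Or.inr he₀)
    simpa using h.add_const ℓ
  rw [averageCost_eq hQ hR.posSemidef]
  refine (limsup_le_limsup (Eventually.of_forall fun N => ?_)).trans hlim.limsup_eq.le
  calc (N : ℝ≥0∞)⁻¹ * ∑ t ∈ Finset.range N,
        expStage A B Q R (sampleLaw μ₀ p S) (linearStrategy fun _ => K) a₀ t
      ≤ (N : ℝ≥0∞)⁻¹ * (e₀ + N * ℓ) := mul_le_mul_right (hval N) _
    _ = (N : ℝ≥0∞)⁻¹ * e₀ + (N : ℝ≥0∞)⁻¹ * N * ℓ := by rw [mul_add, mul_assoc]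
    _ ≤ (N : ℝ≥0∞)⁻¹ * e₀ + ℓ :=
      add_le_add_right (mul_le_of_le_one_left' (ENNReal.inv_mul_le_one _)) _

/-- The `N`-stage values without terminal cost bound every strategy from below, and their averages
converge by Cesàro's theorem. -/
theorem le_averageCost (hQ : Q.PosSemidef) (hR : R.PosDef) (hS : S.PosSemidef)
    (hlim : ∀ b, Tendsto (fun k => (riccati A Q B R p)^[k] 0 b) atTop (nhds (P b))) :
    ENNReal.ofReal (S * modeMean p P).trace
      ≤ averageCost A B Q R (sampleLaw μ₀ p S) γ (followAttack a₀) := by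
  have h0 : ∀ b : Bool, ((0 : Bool → Matrix (Fin n) (Fin n) ℝ) b).PosSemidef := fun _ =>
    PosSemidef.zero
  set ℓ : ℕ → ℝ := fun k => (S * modeMean p ((riccati A Q B R p)^[k] 0)).trace with hℓ
  have hℓ0 : ∀ k, 0 ≤ ℓ k := fun k => trace_mul_nonneg hS
    (modeMean_posSemidef p.2.1 p.2.2 (iterate_riccati_posSemidef hQ hR h0 k))
  have hℓlim : Tendsto ℓ atTop (nhds (S * modeMean p P).trace) := by
    have hc : Continuous fun N : Matrix (Fin n) (Fin n) ℝ => (S * N).trace := by fun_prop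
    exact (hc.tendsto _).comp (tendsto_modeMean hlim)
  have hces := (ENNReal.continuous_ofReal.tendsto _).comp hℓlim.cesaro
  rw [averageCost_eq hQ hR.posSemidef, ← hces.limsup_eq]
  refine limsup_le_limsup ?_
  filter_upwards [eventually_gt_atTop 0] with N hN
  have h := value_le (A := A) (B := B) (μ₀ := μ₀) (p := p) (a₀ := a₀) (γ := γ) hQ hR hS h0 N
  have hz : expForm A B (sampleLaw μ₀ p S) γ a₀ 0 N = 0 := by simp [expForm]
  rw [hz, add_zero] at h
  rw [Function.comp, ENNReal.ofReal_mul (by positivity),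
    ENNReal.ofReal_inv_of_pos (by exact_mod_cast hN), ENNReal.ofReal_natCast,
    ENNReal.ofReal_sum_of_nonneg fun k _ => hℓ0 k]
  exact mul_le_mul_right (le_add_self.trans h) _

end Optimal

end BusOff

theorem theorem3 {n m : ℕ}
    (A : Matrix (Fin n) (Fin n) ℝ) (B : Matrix (Fin n) (Fin m) ℝ)
    (Q : Matrix (Fin n) (Fin n) ℝ) (R : Matrix (Fin m) (Fin m) ℝ)
    (S : Matrix (Fin n) (Fin n) ℝ)
    (hQ : Q.PosSemidef) (hR : R.PosDef) (hS : S.PosSemidef)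
    (μ₀ : Measure (Fin n → ℝ)) [IsProbabilityMeasure μ₀] (hμ₀ : MemLp id 2 μ₀) (a₀ : Bool) :
    (∀ p : unitInterval, 0 < (p : ℝ) → (p : ℝ) < 1 → ∀ N : ℕ,
      ∃ γopt : BusOff.ControlStrategy n m,
        (∀ γ : BusOff.ControlStrategy n m,
          BusOff.finiteCost A B Q R (BusOff.sampleLaw μ₀ p S) γopt (BusOff.followAttack a₀) N ≤
            BusOff.finiteCost A B Q R (BusOff.sampleLaw μ₀ p S) γ (BusOff.followAttack a₀) N) ∧
        ∀ i : ℕ, i < N → ∃ K : Matrix (Fin m) (Fin n) ℝ,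
          ∀ (x : Fin (i + 1) → (Fin n → ℝ)) (a : Fin i → Bool),
            γopt.act i x a = K *ᵥ x (Fin.last i)) ∧
    (BusOff.Controllable A B → BusOff.Controllable A (CFC.sqrt Q) →
      ∃ ρmin : ℝ, IsGLB (BusOff.feasibleRates A B) ρmin ∧
        ∀ p : unitInterval, 0 < (p : ℝ) → (p : ℝ) < 1 → ρmin < (p : ℝ) * (1 - (p : ℝ)) →
          ∃ γopt : BusOff.ControlStrategy n m,
            (∀ γ : BusOff.ControlStrategy n m,
              BusOff.averageCost A B Q R (BusOff.sampleLaw μ₀ p S) γopt (BusOff.followAttack a₀) ≤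
                BusOff.averageCost A B Q R (BusOff.sampleLaw μ₀ p S) γ
                  (BusOff.followAttack a₀)) ∧
            BusOff.averageCost A B Q R (BusOff.sampleLaw μ₀ p S) γopt
              (BusOff.followAttack a₀) < ⊤) := by
  refine ⟨fun p _ _ N => ?_, fun hAB _ => ?_⟩
  · obtain ⟨K, hK⟩ := BusOff.exists_finiteCost_optimal (A := A) (B := B)
      (μ₀ := μ₀) (p := p) (a₀ := a₀) hQ hR hS N
    exact ⟨BusOff.linearStrategy K, hK, fun i _ => ⟨K i, fun _ _ => rfl⟩⟩
  · have hbdd : BddBelow (BusOff.feasibleRates A B) := ⟨0, fun _ hρ => hρ.1⟩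
    have hne : (BusOff.feasibleRates A B).Nonempty := ⟨1, BusOff.one_mem_feasibleRates hAB⟩
    refine ⟨sInf (BusOff.feasibleRates A B), isGLB_csInf hne hbdd, fun p hp hp1 hlt => ?_⟩
    obtain ⟨ρ₀, hρ₀, hρ₀p⟩ := exists_lt_of_csInf_lt hne hlt
    obtain ⟨P, hP, hfix, hlim⟩ := BusOff.exists_riccati_fixedPoint hQ hR hp hp1 hρ₀ hρ₀p
    have hle := BusOff.averageCost_le_of_fixedPoint (A := A) (B := B) (a₀ := a₀) hQ hR hS hμ₀ hP
      hfix
    exact ⟨_, fun γ => hle.trans (BusOff.le_averageCost hQ hR hS hlim),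
      hle.trans_lt ENNReal.ofReal_lt_top⟩
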